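/- Let $U=\begin{bmatrix}U_{RR}&U_{RL}\\U_{LR}&U_{LL}\end{bmatrix}$ be a $2\times2$ unitary matrix and put $a=U_{RR}$, $b=U_{RL}$ (for example $U=\begin{bmatrix}a&b\\-\bar b&\bar a\end{bmatrix}$ with $|a|^2+|b|^2=1$). On $\ell^2(\mathbb Z\times\{R,L\})$ let $Q=T(I\otimes U)$, where $T|x\rangle|R\rangle=|x+1\rangle|R\rangle$ and $T|x\rangle|L\rangle=|x-1\rangle|L\rangle$, and let $\Pi^{\{0,n\}}_{\mathrm{no}}$ be the orthogonal projection onto the closed span of the basis states whose position is neither $0$ nor $n$. For integers $0<m<n$ and $\alpha,\beta\in\mathbb C$ let $$P_n^{(m)}(\alpha,\beta)=\sum_{t=1}^\infty\ \sum_{\sigma\in\{R,L\}}\left|\langle 0,\sigma|\,Q\left(\Pi^{\{0,n\}}_{\mathrm{no}}Q\right)^{t-1}|m\rangle\left(\alpha|R\rangle+\beta|L\rangle\right)\right|^2 ,$$ which, when $|\alpha|^2+|\beta|^2=1$, is the probability that the walk started in $|m\rangle(\alpha|R\rangle+\beta|L\rangle)$ is eventually absorbed at $0$ before being absorbed at $n$.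 Then: 1. The series defining $P_n^{(m)}(\alpha,\beta)$ converges for all integers $0<m<n$ and all $\alpha,\beta\in\mathbb C$. 2. For every integer $n\ge 2$, $$P_{n+1}^{(1)}(1,0)=\frac{|b|^2+P_n^{(1)}(1,0)}{1+P_n^{(1)}(1,0)} .$$ 3. If $a\neq0$, then for all integers $n,m$ with $0<m$ and $m+3<n$ and all $\alpha,\beta\in\mathbb C$, $$P_n^{(m+3)}(\alpha,\beta)-\left(\frac{4}{|a|^2}-1\right)P_n^{(m+2)}(\alpha,\beta)+\left(\frac{4}{|a|^2}-1\right)P_n^{(m+1)}(\alpha,\beta)-P_n^{(m)}(\alpha,\beta)=0 .$$ -/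

import Mathlib

noncomputable section

/-- The state space `ℓ²(ℤ × Σ)` of the two-state walk on the line. The internal state
`0 : Fin 2` is `|R⟩` and `1 : Fin 2` is `|L⟩`. -/
abbrev WalkState : Type := lp (fun _ : ℤ × Fin 2 => ℂ) 2

/-- The displacement of an internal state: `R` moves by `+1`, `L` moves by `-1`. -/
def coinStep : Fin 2 → ℤ := ![1, -1]

theorem memlp_two_iff (f : ℤ × Fin 2 → ℂ) :
    Memℓp f 2 ↔ Summable fun p => ‖f p‖ ^ 2 := by
  rw [memℓp_gen_iff (by norm_num)]
  simp

theorem memlp_shift (ψ : WalkState) :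
    Memℓp (fun p : ℤ × Fin 2 => ψ (p.1 - coinStep p.2, p.2)) 2 := by
  have h := (memlp_two_iff _).1 (lp.memℓp ψ)
  refine (memlp_two_iff _).2 (h.comp_injective
    (i := fun p : ℤ × Fin 2 => (p.1 - coinStep p.2, p.2)) ?_)
  rintro ⟨x, c⟩ ⟨y, d⟩ hxy
  simp only [Prod.mk.injEq] at hxy
  obtain ⟨h1, rfl⟩ := hxy
  simpa using h1

theorem memlp_coin (U : Matrix (Fin 2) (Fin 2) ℂ) (ψ : WalkState) :
    Memℓp (fun p : ℤ × Fin 2 => ∑ d, U p.2 d * ψ (p.1, d)) 2 := by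
  have h := (memlp_two_iff _).1 (lp.memℓp ψ)
  have hd : ∀ d : Fin 2, Summable fun x : ℤ => ‖ψ (x, d)‖ ^ 2 := fun d =>
    h.comp_injective (i := fun x : ℤ => (x, d)) (fun x y hxy => by simpa using hxy)
  refine (memlp_two_iff _).2 ?_
  rw [← (Equiv.prodComm (Fin 2) ℤ).summable_iff]
  refine (summable_prod_of_nonneg (fun _ => sq_nonneg _)).2 ⟨fun c => ?_, .of_finite⟩
  refine Summable.of_nonneg_of_le (fun _ => sq_nonneg _) (fun x => ?_)
    (((hd 0).mul_left (2 * ‖U c 0‖ ^ 2)).add ((hd 1).mul_left (2 * ‖U c 1‖ ^ 2)))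
  simp only [Equiv.prodComm_apply, Prod.swap, Fin.sum_univ_two]
  have h1 := norm_add_le (U c 0 * ψ (x, 0)) (U c 1 * ψ (x, 1))
  rw [norm_mul, norm_mul] at h1
  have h2 := pow_le_pow_left₀ (norm_nonneg _) h1 2
  nlinarith [sq_nonneg (‖U c 0‖ * ‖ψ (x, 0)‖ - ‖U c 1‖ * ‖ψ (x, 1)‖)]

theorem memlp_no (B : Set (ℤ × Fin 2)) (ψ : WalkState) :
    Memℓp (Bᶜ.indicator (fun p => ψ p)) 2 := by
  have h := (memlp_two_iff _).1 (lp.memℓp ψ)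
  refine (memlp_two_iff _).2 (Summable.of_nonneg_of_le (fun _ => sq_nonneg _) (fun p => ?_) h)
  exact pow_le_pow_left₀ (norm_nonneg _) (norm_indicator_le_norm_self _ _) 2

/-- The translation `T : |x⟩|σ⟩ ↦ |x + σ⟩|σ⟩`. -/
def shiftOp : Module.End ℂ WalkState where
  toFun ψ := ⟨fun p => ψ (p.1 - coinStep p.2, p.2), memlp_shift ψ⟩
  map_add' _ _ := rfl
  map_smul' _ _ := rfl

/-- The coin operator `I ⊗ U`: `|x⟩|d⟩ ↦ ∑ c, U c d |x⟩|c⟩`. -/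
def coinOp (U : Matrix (Fin 2) (Fin 2) ℂ) : Module.End ℂ WalkState where
  toFun ψ := ⟨fun p => ∑ d, U p.2 d * ψ (p.1, d), memlp_coin U ψ⟩
  map_add' ψ φ := by
    ext p
    simp only [lp.coeFn_add, Pi.add_apply, mul_add, Finset.sum_add_distrib]
  map_smul' z ψ := by
    ext p
    simp only [lp.coeFn_smul, Pi.smul_apply, smul_eq_mul, RingHom.id_apply, Finset.mul_sum]
    exact Finset.sum_congr rfl fun _ _ => by ring

/-- The quantum walk operator `Q = T (I ⊗ U)`. -/
def walkOp (U : Matrix (Fin 2) (Fin 2) ℂ) : Module.End ℂ WalkState := shiftOp * coinOp U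

/-- The measurement operator `Π_no^B`: the orthogonal projection onto the closed span of the basis
states outside `B`. -/
def noOp (B : Set (ℤ × Fin 2)) : Module.End ℂ WalkState where
  toFun ψ := ⟨Bᶜ.indicator (fun p => ψ p), memlp_no B ψ⟩
  map_add' ψ φ := by
    ext p
    exact congrFun (Set.indicator_add Bᶜ (fun p => ψ p) (fun p => φ p)) p
  map_smul' z ψ := by
    ext p
    by_cases hp : p ∈ Bᶜ <;> simp [hp]

/-- The absorbing units: both internal states at each of the positions `0` and `n`. -/
def boundary (n : ℤ) : Set (ℤ × Fin 2) := {p | p.1 = 0 ∨ p.1 = n}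

/-- The initial state `|m⟩(α|R⟩ + β|L⟩)`. -/
def initState (m : ℤ) (α β : ℂ) : WalkState :=
  lp.single 2 (m, 0) α + lp.single 2 (m, 1) β

/-- The probability of being absorbed at position `0` at time `t + 1`:
`∑_{b ∈ {0} × Σ} |⟨b| Q (Π_no^{0,n} Q)^t |ψ⟩|²`. -/
def absorptionAt (U : Matrix (Fin 2) (Fin 2) ℂ) (n m : ℤ) (α β : ℂ) (t : ℕ) : ℝ :=
  ∑ c : Fin 2,
    ‖(walkOp U (((noOp (boundary n) * walkOp U) ^ t) (initState m α β))) (0, c)‖ ^ 2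

/-- The probability `P_n^{(m)}(α, β)` that the walk started in `|m⟩(α|R⟩ + β|L⟩)` is eventually
absorbed at `0` before being absorbed at `n`. -/
def absorptionProb (U : Matrix (Fin 2) (Fin 2) ℂ) (n m : ℤ) (α β : ℂ) : ℝ :=
  ∑' t : ℕ, absorptionAt U n m α β t

end

/-!
The idea is to replace sums over time by averages over the unit circle.

If the coin has nonzero diagonal, a confined state leaves every site, so absorption at `0` is
described by the generating function in time of the absorption amplitudes. This function solves the
stationary scattering problem on the interval, and after removing phases from the coin
(`CoinPhases`) it is an explicit quotient (`pairing`) of Chebyshev expressions `V_k = U_{k-1}` at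
`X = (ζ + ζ⁻¹) / ρ`, `ρ = |a|`, with the denominator `y = leftAmp ρ N`, where `n = N + 1`. The
reflection coefficient is bounded by `1` on the closed disc (`scatPair_bound`), so `ζ ^ N y` has no
zeros there and the mean value property annihilates the circle average of `f / y` whenever `f` has a
pole of order less than `N` at `0` (`circleAverage_div_leftAmp`). In particular `pairing` has mean
zero, its squared `L²` norm drops in each step exactly by the probability absorbed at `0`
(`CoinPhases.pairingEnergy_eq`), and therefore the absorption probability is the circle average of
the squared modulus of the generating function (`CoinPhases.hasSum_absorbed`).

For the start at `1` in state `R` this is a multiple of the average of `|g|²`, `g = V_N / y`. On the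
circle `|g|² (ζ - ζ⁻¹) = ρ (g - ḡ)`, and as `g` is odd, subtracting `g(1) ζ` makes the right-hand
side divisible by `ζ - ζ⁻¹`; hence the average of `|g|²` is `ρ g(1)` (`circleAverage_chebV_sq`). So
the probability is the value at `ζ = 1` of a reflection coefficient, which obeys a Möbius recursion
in `N`.

For a general start, the squared modulus satisfies pointwise a third-order recurrence in `m` with
coefficient `X² - 1` in place of `4 / ρ² - 1`. The discrepancy is `(ζ - ζ⁻¹)² / ρ²` times `V_j`
divided by `y ȳ` (`quadForm_recurrence`). The identity `2 V_j = V_N C_i - C_N V_i`, where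
`C_k = V_{k+1} - V_{k-1}` and `i = N - j`, writes it as the real part of some `G / y` with `G`
having a pole of order less than `N`, so its average vanishes (`circleAverage_sq_mul_chebV`).

If the diagonal of the coin vanishes, the walker turns around at every step, so that started at `1` in
state `R` it is absorbed at `0` at once.
Summability holds for every coin because probability is conserved (`mass_stepOp`).
-/

noncomputable section

open Filter Topology ComplexConjugate

/-! ### Dynamics and conservation of probability -/

theorem walkOp_apply_zero (U : Matrix (Fin 2) (Fin 2) ℂ) (ψ : WalkState) (x : ℤ) :
    walkOp U ψ (x, 0) = U 0 0 * ψ (x - 1, 0) + U 0 1 * ψ (x - 1, 1) := by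
  change ∑ d, U 0 d * ψ (x - 1, d) = _
  rw [Fin.sum_univ_two]

theorem walkOp_apply_one (U : Matrix (Fin 2) (Fin 2) ℂ) (ψ : WalkState) (x : ℤ) :
    walkOp U ψ (x, 1) = U 1 0 * ψ (x + 1, 0) + U 1 1 * ψ (x + 1, 1) := by
  change ∑ d, U 1 d * ψ (x - (-1), d) = _
  rw [Fin.sum_univ_two, sub_neg_eq_add]

/-- One step of the walk, followed by the measurement at the boundary `{0, n}`. -/
def stepOp (U : Matrix (Fin 2) (Fin 2) ℂ) (n : ℤ) : Module.End ℂ WalkState :=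
  noOp (boundary n) * walkOp U

theorem stepOp_apply (U : Matrix (Fin 2) (Fin 2) ℂ) (n : ℤ) (ψ : WalkState) (x : ℤ) (c : Fin 2) :
    stepOp U n ψ (x, c) = if x = 0 ∨ x = n then 0 else walkOp U ψ (x, c) := by
  change (boundary n)ᶜ.indicator (fun p => walkOp U ψ p) (x, c) = _
  by_cases h : x = 0 ∨ x = n <;> simp [boundary, h]

/-- The state vanishes off the interior sites `0 < x < n`. -/
def Confined (n : ℤ) (ψ : WalkState) : Prop :=
  ∀ (x : ℤ) (c : Fin 2), ¬(0 < x ∧ x < n) → ψ (x, c) = 0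

theorem Confined.stepOp {n : ℤ} {ψ : WalkState} (U : Matrix (Fin 2) (Fin 2) ℂ)
    (h : Confined n ψ) : Confined n (stepOp U n ψ) := by
  intro x c hx
  rw [stepOp_apply]
  split_ifs with hb
  · rfl
  · fin_cases c
    · simp only [Fin.zero_eta, walkOp_apply_zero]
      rw [h _ 0 (by omega), h _ 1 (by omega)]; simp
    · simp only [Fin.mk_one, walkOp_apply_one]
      rw [h _ 0 (by omega), h _ 1 (by omega)]; simp

theorem stepOp_pow_succ (U : Matrix (Fin 2) (Fin 2) ℂ) (n : ℤ) (ψ : WalkState) (t : ℕ) :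
    (stepOp U n ^ (t + 1)) ψ = stepOp U n ((stepOp U n ^ t) ψ) := by
  rw [pow_succ', Module.End.mul_apply]

theorem Confined.pow {n : ℤ} {ψ : WalkState} (U : Matrix (Fin 2) (Fin 2) ℂ)
    (h : Confined n ψ) (t : ℕ) : Confined n ((_root_.stepOp U n ^ t) ψ) := by
  induction t with
  | zero => simpa using h
  | succ t ih =>
    rw [stepOp_pow_succ]
    exact ih.stepOp U

theorem initState_apply (m : ℤ) (α β : ℂ) (x : ℤ) (c : Fin 2) :
    initState m α β (x, c) = if x = m then (if c = 0 then α else β) else 0 := by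
  by_cases hx : x = m
  · subst hx
    fin_cases c <;> simp [initState]
  · fin_cases c <;> simp [initState, hx]

theorem confined_initState {n m : ℤ} (h0 : 0 < m) (hn : m < n) (α β : ℂ) :
    Confined n (initState m α β) := by
  intro x c hx
  rw [initState_apply, if_neg]
  rintro rfl
  exact hx ⟨h0, hn⟩

/-- From a confined state, only the internal state `L` can arrive at `0`. -/
theorem absorptionAt_eq {n m : ℤ} (h0 : 0 < m) (hn : m < n) (U : Matrix (Fin 2) (Fin 2) ℂ)
    (α β : ℂ) (t : ℕ) :
    absorptionAt U n m α β t
      = ‖walkOp U ((stepOp U n ^ t) (initState m α β)) (0, 1)‖ ^ 2 := by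
  have h := (confined_initState h0 hn α β).pow U t
  change ∑ c : Fin 2, ‖walkOp U ((stepOp U n ^ t) (initState m α β)) (0, c)‖ ^ 2 = _
  rw [Fin.sum_univ_two, walkOp_apply_zero, h _ 0 (by omega), h _ 1 (by omega)]
  simp

theorem sum_Ioo_add_one {M : Type*} [AddCommGroup M] {n : ℤ} (hn : 2 ≤ n) (f : ℤ → M) :
    ∑ x ∈ Finset.Ioo 0 n, f (x + 1) = ∑ x ∈ Finset.Ioo 0 n, f x + f n - f 1 := by
  induction n, hn using Int.leInduction with
  | base =>
    have : Finset.Ioo (0 : ℤ) 2 = {1} := by decide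
    simp [this]
  | succ k hk ih =>
    have : Finset.Ioo (0 : ℤ) (k + 1) = insert k (Finset.Ioo 0 k) := by
      ext x; simp only [Finset.mem_Ioo, Finset.mem_insert]; omega
    rw [this, Finset.sum_insert (by simp), Finset.sum_insert (by simp), ih]
    abel

theorem sum_Ioo_sub_one {M : Type*} [AddCommGroup M] {n : ℤ} (hn : 2 ≤ n) (f : ℤ → M) :
    ∑ x ∈ Finset.Ioo 0 n, f (x - 1) = ∑ x ∈ Finset.Ioo 0 n, f x + f 0 - f (n - 1) := by
  have h := sum_Ioo_add_one hn (fun x => f (x - 1))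
  simp only [add_sub_cancel_right, sub_self] at h
  rw [h]; abel

/-- The squared norm of the part of the state that lies in the interior `0 < x < n`. -/
def mass (n : ℤ) (ψ : WalkState) : ℝ :=
  ∑ x ∈ Finset.Ioo 0 n, (‖ψ (x, 0)‖ ^ 2 + ‖ψ (x, 1)‖ ^ 2)

theorem mass_nonneg (n : ℤ) (ψ : WalkState) : 0 ≤ mass n ψ :=
  Finset.sum_nonneg fun _ _ => by positivity

theorem unitary_norm_sq {U : Matrix (Fin 2) (Fin 2) ℂ} (hU : U ∈ Matrix.unitaryGroup (Fin 2) ℂ)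
    (x y : ℂ) :
    ‖U 0 0 * x + U 0 1 * y‖ ^ 2 + ‖U 1 0 * x + U 1 1 * y‖ ^ 2 = ‖x‖ ^ 2 + ‖y‖ ^ 2 := by
  have h := Matrix.mem_unitaryGroup_iff'.1 hU
  have h00 := congrFun (congrFun h 0) 0
  have h01 := congrFun (congrFun h 0) 1
  have h10 := congrFun (congrFun h 1) 0
  have h11 := congrFun (congrFun h 1) 1
  simp [Matrix.mul_apply, Fin.sum_univ_two, Matrix.star_apply] at h00 h01 h10 h11
  apply Complex.ofReal_injective
  push_cast
  simp only [← Complex.mul_conj', map_add, map_mul]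
  linear_combination x * (starRingEnd ℂ) x * h00 + y * (starRingEnd ℂ) y * h11
    + (starRingEnd ℂ) x * y * h01 + x * (starRingEnd ℂ) y * h10

/-- Conservation of probability: the mass lost in a step is what reaches `0` or `n`. -/
theorem mass_stepOp {U : Matrix (Fin 2) (Fin 2) ℂ} (hU : U ∈ Matrix.unitaryGroup (Fin 2) ℂ)
    {n : ℤ} (hn : 2 ≤ n) {ψ : WalkState} (h : Confined n ψ) :
    mass n (stepOp U n ψ) + ‖walkOp U ψ (0, 1)‖ ^ 2 + ‖walkOp U ψ (n, 0)‖ ^ 2 = mass n ψ := by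
  have h1 : mass n (stepOp U n ψ) = ∑ x ∈ Finset.Ioo 0 n, ‖walkOp U ψ (x, 0)‖ ^ 2
      + ∑ x ∈ Finset.Ioo 0 n, ‖walkOp U ψ (x, 1)‖ ^ 2 := by
    rw [mass, ← Finset.sum_add_distrib]
    refine Finset.sum_congr rfl fun x hx => ?_
    have := Finset.mem_Ioo.1 hx
    rw [stepOp_apply, stepOp_apply, if_neg (by omega), if_neg (by omega)]
  have hR := sum_Ioo_add_one hn (fun x => ‖walkOp U ψ (x, 0)‖ ^ 2)
  have hL := sum_Ioo_sub_one hn (fun x => ‖walkOp U ψ (x, 1)‖ ^ 2)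
  have e1 : walkOp U ψ (1, 0) = 0 := by
    rw [walkOp_apply_zero, h _ 0 (by omega), h _ 1 (by omega)]; simp
  have e2 : walkOp U ψ (n - 1, 1) = 0 := by
    rw [walkOp_apply_one, h _ 0 (by omega), h _ 1 (by omega)]; simp
  have h2 : mass n ψ = ∑ x ∈ Finset.Ioo 0 n, ‖walkOp U ψ (x + 1, 0)‖ ^ 2
      + ∑ x ∈ Finset.Ioo 0 n, ‖walkOp U ψ (x - 1, 1)‖ ^ 2 := by
    rw [mass, ← Finset.sum_add_distrib]
    refine Finset.sum_congr rfl fun x hx => ?_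
    rw [walkOp_apply_zero, walkOp_apply_one, add_sub_cancel_right, sub_add_cancel,
      unitary_norm_sq hU]
  simp only [e1, e2, norm_zero] at hR hL
  rw [h1, h2, hR, hL]
  ring

theorem sum_absorbed_le_mass {U : Matrix (Fin 2) (Fin 2) ℂ}
    (hU : U ∈ Matrix.unitaryGroup (Fin 2) ℂ) {n : ℤ} (hn : 2 ≤ n) {ψ : WalkState}
    (h : Confined n ψ) (T : ℕ) :
    ∑ t ∈ Finset.range T, ‖walkOp U ((stepOp U n ^ t) ψ) (0, 1)‖ ^ 2
      + mass n ((stepOp U n ^ T) ψ) ≤ mass n ψ := by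
  induction T with
  | zero => simp
  | succ T ih =>
    have := mass_stepOp hU hn (h.pow U T)
    rw [Finset.sum_range_succ, stepOp_pow_succ]
    linarith [sq_nonneg ‖walkOp U ((stepOp U n ^ T) ψ) (n, 0)‖]

theorem summable_absorbed {U : Matrix (Fin 2) (Fin 2) ℂ}
    (hU : U ∈ Matrix.unitaryGroup (Fin 2) ℂ) {n : ℤ} (hn : 2 ≤ n) {ψ : WalkState}
    (h : Confined n ψ) :
    Summable fun t : ℕ => ‖walkOp U ((stepOp U n ^ t) ψ) (0, 1)‖ ^ 2 :=
  summable_of_sum_range_le (fun _ => sq_nonneg _) fun T => by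
    linarith [sum_absorbed_le_mass hU hn h T, mass_nonneg n ((stepOp U n ^ T) ψ)]

/-- If the coin has nonzero diagonal, the state leaves every site: the amplitude arriving at `0`
tends to `0`, and this propagates through the interior from left to right. -/
theorem tendsto_state_zero {U : Matrix (Fin 2) (Fin 2) ℂ}
    (hU : U ∈ Matrix.unitaryGroup (Fin 2) ℂ) (hd : U 1 1 ≠ 0) {n : ℤ} (hn : 2 ≤ n)
    {ψ : WalkState} (h : Confined n ψ) (x : ℤ) (c : Fin 2) :
    Tendsto (fun t : ℕ => ((stepOp U n ^ t) ψ) (x, c)) atTop (𝓝 0) := by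
  have habs : Tendsto (fun t : ℕ => walkOp U ((stepOp U n ^ t) ψ) (0, 1)) atTop (𝓝 0) := by
    have h1 := (summable_absorbed hU hn h).tendsto_atTop_zero
    rw [tendsto_zero_iff_norm_tendsto_zero]
    simpa using h1.sqrt
  -- At site `k + 1`, the amplitude of `R` is what was sent from site `k` one step earlier, and the
  -- amplitude of `L` is recovered, as `U 1 1 ≠ 0`, from what it sends to site `k` one step later.
  have hstep : ∀ k : ℕ, ∀ c : Fin 2,
      Tendsto (fun t : ℕ => ((stepOp U n ^ t) ψ) ((k : ℤ), c)) atTop (𝓝 0) := by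
    intro k
    induction k with
    | zero =>
      intro c
      refine tendsto_const_nhds.congr fun t => ?_
      rw [h.pow U t _ c (by simp)]
    | succ k ih =>
      by_cases hk : (k : ℤ) + 1 < n
      · have hR : Tendsto (fun t : ℕ => ((stepOp U n ^ t) ψ) ((k : ℤ) + 1, 0)) atTop (𝓝 0) := by
          rw [← tendsto_add_atTop_iff_nat 1]
          have h2 := ((ih 0).const_mul (U 0 0)).add ((ih 1).const_mul (U 0 1))
          simp only [mul_zero, add_zero] at h2
          refine h2.congr fun t => ?_
          rw [stepOp_pow_succ, stepOp_apply, if_neg (by omega),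
            walkOp_apply_zero, add_sub_cancel_right]
        have hL : Tendsto (fun t : ℕ => walkOp U ((stepOp U n ^ t) ψ) ((k : ℤ), 1)) atTop
            (𝓝 0) := by
          rcases Nat.eq_zero_or_pos k with rfl | hk0
          · simpa using habs
          · have h3 := (tendsto_add_atTop_iff_nat 1).2 (ih 1)
            refine h3.congr fun t => ?_
            rw [stepOp_pow_succ, stepOp_apply, if_neg (by omega)]
        have hL' : Tendsto (fun t : ℕ => ((stepOp U n ^ t) ψ) ((k : ℤ) + 1, 1)) atTop (𝓝 0) := by
          have h4 := (hL.sub (hR.const_mul (U 1 0))).const_mul (U 1 1)⁻¹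
          simp only [mul_zero, sub_zero] at h4
          refine h4.congr fun t => ?_
          rw [walkOp_apply_one]
          field_simp
          ring
        intro c
        push_cast
        fin_cases c
        · exact hR
        · exact hL'
      · intro c
        refine tendsto_const_nhds.congr fun t => ?_
        rw [h.pow U t _ c (by push_cast; omega)]
  by_cases hx : 0 < x
  · lift x to ℕ using hx.le
    exact hstep x c
  · refine tendsto_const_nhds.congr fun t => ?_
    rw [h.pow U t _ c (by omega)]

/-! ### Chebyshev values and the scattering denominator -/

/-- The Chebyshev value `V_k(ζ) = U_{k-1}(cos θ / ρ)` for `ζ = exp (iθ)`, indexed so that `V_0 = 0`,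
`V_1 = 1` and `V_{-k} = -V_k`. -/
def chebV (ρ : ℝ) (k : ℤ) (ζ : ℂ) : ℂ :=
  (Polynomial.Chebyshev.S ℂ (k - 1)).eval ((ζ + ζ⁻¹) / ρ)

theorem chebV_zero (ρ : ℝ) (ζ : ℂ) : chebV ρ 0 ζ = 0 := by simp [chebV]

theorem chebV_one (ρ : ℝ) (ζ : ℂ) : chebV ρ 1 ζ = 1 := by simp [chebV]

theorem chebV_add_one (ρ : ℝ) (k : ℤ) (ζ : ℂ) :
    chebV ρ (k + 1) ζ = (ζ + ζ⁻¹) / ρ * chebV ρ k ζ - chebV ρ (k - 1) ζ := by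
  have h := Polynomial.Chebyshev.S_add_one ℂ (k - 1)
  rw [sub_add_cancel] at h
  simp [chebV, h]

theorem chebV_neg (ρ : ℝ) (k : ℤ) (ζ : ℂ) : chebV ρ (-k) ζ = -chebV ρ k ζ := by
  simp [chebV, Polynomial.Chebyshev.S_neg_sub_one]

theorem chebV_add (ρ : ℝ) (i j : ℤ) (ζ : ℂ) :
    chebV ρ (i + j) ζ = chebV ρ (i + 1) ζ * chebV ρ j ζ - chebV ρ i ζ * chebV ρ (j - 1) ζ := by
  have hm : chebV ρ (-1) ζ = -1 := by rw [chebV_neg, chebV_one]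
  induction j using Polynomial.Chebyshev.induct with
  | zero => simp [chebV_zero, hm]
  | one => simp [chebV_zero, chebV_one]
  | add_two n h1 h2 =>
    have e1 := chebV_add_one ρ (i + (n + 1)) ζ
    have e2 := chebV_add_one ρ ((n : ℤ) + 1) ζ
    have e3 := chebV_add_one ρ (n : ℤ) ζ
    rw [show i + ((n : ℤ) + 2) = i + (n + 1) + 1 by ring, e1,
      show i + ((n : ℤ) + 1) - 1 = i + n by ring, h1, h2,
      show (n : ℤ) + 2 - 1 = n + 1 by ring, show (n : ℤ) + 2 = n + 1 + 1 by ring, e2,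
      add_sub_cancel_right, e3]
    ring
  | neg_add_one n h1 h2 =>
    have e1 := chebV_add_one ρ (i + -n) ζ
    have e2 := chebV_add_one ρ (-(n : ℤ)) ζ
    have e3 := chebV_add_one ρ (-(n : ℤ) - 1) ζ
    rw [show i + -(n : ℤ) + 1 = i + (-n + 1) by ring, h1, h2,
      show i + -(n : ℤ) - 1 = i + (-n - 1) by ring, add_sub_cancel_right] at e1
    rw [sub_add_cancel] at e3
    linear_combination e1 - chebV ρ (i + 1) ζ * e2 + chebV ρ i ζ * e3

theorem conj_eq_inv_of_norm_one {ζ : ℂ} (h : ‖ζ‖ = 1) : conj ζ = ζ⁻¹ := by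
  rw [Complex.inv_eq_conj h]

theorem conj_chebV {ρ : ℝ} {ζ : ℂ} (h : ‖ζ‖ = 1) (k : ℤ) :
    conj (chebV ρ k ζ) = chebV ρ k ζ := by
  have hX : conj ((ζ + ζ⁻¹) / (ρ : ℂ)) = (ζ + ζ⁻¹) / ρ := by
    rw [map_div₀, map_add, map_inv₀, conj_eq_inv_of_norm_one h, Complex.conj_ofReal, inv_inv,
      add_comm]
  have h0 : ∀ k, conj (chebV ρ k ζ) = chebV ρ k ζ ∧
      conj (chebV ρ (k + 1) ζ) = chebV ρ (k + 1) ζ := by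
    intro k
    induction k using Int.induction_on with
    | zero => simp [chebV_zero, chebV_one]
    | succ n ih =>
      refine ⟨ih.2, ?_⟩
      rw [chebV_add_one, map_sub, map_mul, hX, ih.2, add_sub_cancel_right, ih.1]
    | pred n ih =>
      have e := chebV_add_one ρ (-(n : ℤ)) ζ
      have e' := congrArg conj e
      rw [map_sub, map_mul, hX, ih.1, ih.2] at e'
      rw [sub_add_cancel]
      exact ⟨by linear_combination e' - e, ih.1⟩
  exact (h0 k).1

/-- The left-moving amplitude `V_{k+1} - ζ V_k / ρ` on the edge at distance `k` from the right
barrier, normalized to be `1` for `k = 0`. -/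
def leftAmp (ρ : ℝ) (k : ℤ) (ζ : ℂ) : ℂ := chebV ρ (k + 1) ζ - ζ / ρ * chebV ρ k ζ

/-- The complex conjugate of `leftAmp` on the unit circle, written without conjugation. -/
def leftAmpConj (ρ : ℝ) (k : ℤ) (ζ : ℂ) : ℂ := chebV ρ (k + 1) ζ - ζ⁻¹ / ρ * chebV ρ k ζ

theorem conj_leftAmp {ρ : ℝ} {ζ : ℂ} (h : ‖ζ‖ = 1) (k : ℤ) :
    conj (leftAmp ρ k ζ) = leftAmpConj ρ k ζ := by
  rw [leftAmp, leftAmpConj, map_sub, map_mul, map_div₀, conj_chebV h, conj_chebV h,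
    conj_eq_inv_of_norm_one h, Complex.conj_ofReal]

/-- The entire functions `ζ ^ k V_k(ζ)` and `ζ ^ k leftAmp k ζ`. -/
def scatPair (ρ : ℝ) : ℕ → ℂ → ℂ × ℂ
  | 0, _ => (0, 1)
  | k + 1, ζ => (ζ * (scatPair ρ k ζ).2 + ζ ^ 2 / ρ * (scatPair ρ k ζ).1,
      ((scatPair ρ k ζ).2 + (1 - ρ ^ 2) / ρ * ζ * (scatPair ρ k ζ).1) / ρ)

theorem scatPair_eq {ρ : ℝ} (hρ : 0 < ρ) {ζ : ℂ} (hζ : ζ ≠ 0) (k : ℕ) :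
    (scatPair ρ k ζ).1 = ζ ^ k * chebV ρ k ζ ∧ (scatPair ρ k ζ).2 = ζ ^ k * leftAmp ρ k ζ := by
  have hρ' : (ρ : ℂ) ≠ 0 := by exact_mod_cast hρ.ne'
  induction k with
  | zero => simp [scatPair, leftAmp, chebV_zero, chebV_one]
  | succ k ih =>
    have e := chebV_add_one ρ ((k : ℤ) + 1) ζ
    rw [add_sub_cancel_right] at e
    simp only [scatPair, ih.1, ih.2]
    push_cast
    simp only [leftAmp, e]
    constructor
    · field_simp
      ring
    · field_simp
      ring

theorem differentiable_scatPair (ρ : ℝ) (k : ℕ) :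
    Differentiable ℂ (fun ζ => (scatPair ρ k ζ).1) ∧
      Differentiable ℂ (fun ζ => (scatPair ρ k ζ).2) := by
  induction k with
  | zero => simp [scatPair]
  | succ k ih =>
    have h1 := ih.1
    have h2 := ih.2
    simp only [scatPair]
    exact ⟨by fun_prop, by fun_prop⟩

theorem scatPair_neg (ρ : ℝ) (k : ℕ) (ζ : ℂ) :
    (scatPair ρ k (-ζ)).1 = -(scatPair ρ k ζ).1 ∧ (scatPair ρ k (-ζ)).2 = (scatPair ρ k ζ).2 := by
  induction k with
  | zero => simp [scatPair]
  | succ k ih =>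
    simp only [scatPair, ih.1, ih.2]
    exact ⟨by ring, by ring⟩

/-- A disc automorphism does not leave the disc, in homogeneous form. -/
theorem norm_sub_le_norm_sub {s : ℝ} (hs : s ^ 2 ≤ 1) {v D : ℂ} (h : ‖v‖ ≤ ‖D‖) :
    ‖v - s * D‖ ≤ ‖D - s * v‖ := by
  have h2 : ‖v‖ ^ 2 ≤ ‖D‖ ^ 2 := pow_le_pow_left₀ (norm_nonneg _) h 2
  refine le_of_sq_le_sq ?_ (norm_nonneg _)
  simp only [Complex.sq_norm, Complex.normSq_apply, Complex.sub_re, Complex.sub_im, Complex.mul_re,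
    Complex.mul_im, Complex.ofReal_re, Complex.ofReal_im] at h2 ⊢
  nlinarith [mul_nonneg (sub_nonneg.2 hs) (sub_nonneg.2 h2)]

/-- The reflection amplitude is bounded by `1` on the closed disc, so that the denominator has no
zeros there. -/
theorem scatPair_bound {ρ s : ℝ} (hρ : 0 < ρ) (hs : 0 ≤ s) (hρs : ρ ^ 2 + s ^ 2 = 1) {ζ : ℂ}
    (hζ : ‖ζ‖ ≤ 1) (k : ℕ) :
    ‖(s / ρ : ℂ) * (scatPair ρ k ζ).1‖ ≤ ‖(scatPair ρ k ζ).2‖ ∧ (scatPair ρ k ζ).2 ≠ 0 := by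
  have hρ' : (ρ : ℂ) ≠ 0 := by exact_mod_cast hρ.ne'
  have hρs' : (1 - ρ ^ 2 : ℂ) = s ^ 2 := by
    have : (ρ ^ 2 + s ^ 2 : ℂ) = 1 := by exact_mod_cast hρs
    linear_combination -this
  induction k with
  | zero => simp [scatPair]
  | succ k ih =>
    obtain ⟨h1, h2⟩ := ih
    set A := (scatPair ρ k ζ).1
    set D := (scatPair ρ k ζ).2
    have hv : ‖ζ * (-(s / ρ : ℂ) * A)‖ ≤ ‖D‖ := by
      rw [norm_mul, neg_mul, norm_neg]
      exact (mul_le_of_le_one_left (norm_nonneg _) hζ).trans h1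
    have e2 : (scatPair ρ (k + 1) ζ).2 = (D - s * (ζ * (-(s / ρ : ℂ) * A))) / ρ := by
      simp only [scatPair, hρs']
      ring
    have e1 : (s / ρ : ℂ) * (scatPair ρ (k + 1) ζ).1
        = -(ζ * ((ζ * (-(s / ρ : ℂ) * A) - s * D) / ρ)) := by
      simp only [scatPair]
      ring
    have hs1 : s ^ 2 < 1 := by nlinarith
    have hs1' : s < 1 := by nlinarith
    constructor
    · rw [e1, e2, norm_neg, norm_mul, norm_div, norm_div]
      refine (mul_le_of_le_one_left (by positivity) hζ).trans ?_
      gcongr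
      exact norm_sub_le_norm_sub hs1.le hv
    · rw [e2]
      refine div_ne_zero ?_ hρ'
      intro h0
      have h3 : ‖D‖ = s * ‖ζ * (-(s / ρ : ℂ) * A)‖ := by
        rw [sub_eq_zero.1 h0, norm_mul, Complex.norm_real, Real.norm_of_nonneg hs]
      have h4 : 0 < ‖D‖ := norm_pos_iff.2 h2
      nlinarith [mul_le_mul_of_nonneg_left hv hs]

theorem leftAmp_ne_zero {ρ s : ℝ} (hρ : 0 < ρ) (hs : 0 ≤ s) (hρs : ρ ^ 2 + s ^ 2 = 1) {ζ : ℂ}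
    (hζ : ‖ζ‖ = 1) (k : ℕ) : leftAmp ρ k ζ ≠ 0 := by
  have h0 : ζ ≠ 0 := by rintro rfl; simp at hζ
  have h := (scatPair_bound hρ hs hρs hζ.le k).2
  rw [(scatPair_eq hρ h0 k).2] at h
  exact right_ne_zero_of_mul h

/-! ### Circle averages of quotients by the denominator -/

/-- `f` is holomorphic on the punctured plane, with a pole of order at most `p` at `0`. -/
def PoleLE (p : ℕ) (f : ℂ → ℂ) : Prop :=
  ∃ g : ℂ → ℂ, Differentiable ℂ g ∧ ∀ ζ ≠ 0, ζ ^ p * f ζ = g ζ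

namespace PoleLE

variable {p q : ℕ} {f g : ℂ → ℂ}

theorem of_differentiable (hf : Differentiable ℂ f) : PoleLE 0 f := ⟨f, hf, by simp⟩

theorem const (c : ℂ) : PoleLE 0 fun _ => c := of_differentiable (differentiable_const c)

theorem inv : PoleLE 1 fun ζ : ℂ => ζ⁻¹ :=
  ⟨fun _ => 1, differentiable_const 1, fun _ h => by simp [h]⟩

theorem mono (hf : PoleLE p f) (h : p ≤ q) : PoleLE q f := by
  obtain ⟨F, hF, e⟩ := hf
  refine ⟨fun ζ => ζ ^ (q - p) * F ζ, by fun_prop, fun ζ hζ => ?_⟩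
  beta_reduce
  rw [← e ζ hζ, ← mul_assoc, ← pow_add, Nat.sub_add_cancel h]

theorem add (hf : PoleLE p f) (hg : PoleLE p g) : PoleLE p fun ζ => f ζ + g ζ := by
  obtain ⟨F, hF, e⟩ := hf
  obtain ⟨G, hG, e'⟩ := hg
  exact ⟨fun ζ => F ζ + G ζ, by fun_prop, fun ζ hζ => by rw [mul_add, e ζ hζ, e' ζ hζ]⟩

theorem mul (hf : PoleLE p f) (hg : PoleLE q g) : PoleLE (p + q) fun ζ => f ζ * g ζ := by
  obtain ⟨F, hF, e⟩ := hf
  obtain ⟨G, hG, e'⟩ := hg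
  exact ⟨fun ζ => F ζ * G ζ, by fun_prop, fun ζ hζ => by
    beta_reduce
    rw [← e ζ hζ, ← e' ζ hζ]
    ring⟩

theorem const_mul (c : ℂ) (hf : PoleLE p f) : PoleLE p fun ζ => c * f ζ :=
  ((const c).mul hf).mono (by omega)

theorem sub (hf : PoleLE p f) (hg : PoleLE p g) : PoleLE p fun ζ => f ζ - g ζ := by
  simpa [sub_eq_add_neg] using hf.add (hg.const_mul (-1))

theorem continuousOn (hf : PoleLE p f) : ContinuousOn f (Metric.sphere 0 |1|) := by
  obtain ⟨F, hF, e⟩ := hf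
  have h0 : ∀ ζ ∈ Metric.sphere (0 : ℂ) |1|, ζ ≠ 0 := by
    rintro ζ h rfl
    simp at h
  refine ContinuousOn.congr (f := fun ζ => F ζ / ζ ^ p) ?_ fun ζ h => ?_
  · exact hF.continuous.continuousOn.div (by fun_prop) fun ζ h => pow_ne_zero _ (h0 ζ h)
  · beta_reduce
    rw [← e ζ (h0 ζ h), mul_div_cancel_left₀ _ (pow_ne_zero _ (h0 ζ h))]

end PoleLE

theorem poleLE_chebV {ρ : ℝ} (hρ : 0 < ρ) (k : ℤ) : PoleLE (k.natAbs - 1) (chebV ρ k) := by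
  have hnat : ∀ k : ℕ, PoleLE (k - 1) (chebV ρ k) := by
    intro k
    cases k with
    | zero => exact ⟨fun _ => 0, differentiable_const 0, by simp [chebV_zero]⟩
    | succ k =>
      have h1 := (differentiable_scatPair ρ k).1
      have h2 := (differentiable_scatPair ρ k).2
      refine ⟨fun ζ => (scatPair ρ k ζ).2 + ζ / ρ * (scatPair ρ k ζ).1, by fun_prop,
        fun ζ hζ => ?_⟩
      beta_reduce
      rw [(scatPair_eq hρ hζ k).1, (scatPair_eq hρ hζ k).2, leftAmp]
      push_cast
      ring
  rcases Int.natAbs_eq k with h | h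
  · have := hnat k.natAbs
    rwa [← h] at this
  · have := (hnat k.natAbs).const_mul (-1)
    have e : (fun ζ => -1 * chebV ρ (k.natAbs : ℤ) ζ) = chebV ρ k := by
      ext ζ
      conv_rhs => rw [h, chebV_neg]
      ring
    rwa [e] at this

theorem poleLE_leftAmp {ρ : ℝ} (hρ : 0 < ρ) (k : ℕ) : PoleLE k (leftAmp ρ k) :=
  ⟨_, (differentiable_scatPair ρ k).2, fun _ hζ => ((scatPair_eq hρ hζ k).2).symm⟩

theorem circleAverage_conj {f : ℂ → ℂ} (hf : ContinuousOn f (Metric.sphere 0 |1|)) :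
    Real.circleAverage (fun ζ => conj (f ζ)) 0 1 = conj (Real.circleAverage f 0 1) :=
  (Complex.conjCLE : ℂ →L[ℝ] ℂ).circleAverage_comp_comm hf.circleIntegrable'

theorem sum_mul_circleAverage_eq_zero {ι : Type*} [Fintype ι] (c : ι → ℂ) (F : ι → ℂ → ℂ)
    (hF : ∀ i, ContinuousOn (F i) (Metric.sphere 0 |1|))
    (h : ∀ ζ : ℂ, ‖ζ‖ = 1 → ∑ i, c i * F i ζ = 0) :
    ∑ i, c i * Real.circleAverage (F i) 0 1 = 0 := by
  have h1 : ∀ i, c i * Real.circleAverage (F i) 0 1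
      = Real.circleAverage (fun ζ => c i * F i ζ) 0 1 := fun i =>
    (Real.circleAverage_fun_smul (a := c i) (f := F i) (c := 0) (R := 1)).symm
  rw [Finset.sum_congr rfl fun i _ => h1 i, ← Real.circleAverage_fun_sum
    (f := fun i ζ => c i * F i ζ) fun i _ => (continuousOn_const.mul (hF i)).circleIntegrable']
  rw [Real.circleAverage_congr_sphere (f₂ := fun _ => 0), Real.circleAverage_const]
  intro ζ hζ
  exact h ζ (by simpa using hζ)

/-- The mean value property at the centre of the disc. -/
theorem circleAverage_mul_div_scatPair {ρ s : ℝ} (hρ : 0 < ρ) (hs : 0 ≤ s)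
    (hρs : ρ ^ 2 + s ^ 2 = 1) {g : ℂ → ℂ} (hg : Differentiable ℂ g) (N : ℕ) :
    Real.circleAverage (fun ζ => ζ * g ζ / (scatPair ρ N ζ).2) 0 1 = 0 := by
  have hd : DiffContOnCl ℂ (fun ζ => ζ * g ζ / (scatPair ρ N ζ).2) (Metric.ball 0 |1|) := by
    refine DifferentiableOn.diffContOnCl_ball (U := Metric.closedBall 0 1) ?_ (by simp)
    refine (differentiable_id.mul hg).differentiableOn.div
      (differentiable_scatPair ρ N).2.differentiableOn fun ζ hζ => ?_
    exact (scatPair_bound hρ hs hρs (by simpa using hζ) N).2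
  rw [hd.circleAverage]
  simp

theorem circleAverage_div_leftAmp {ρ s : ℝ} (hρ : 0 < ρ) (hs : 0 ≤ s) (hρs : ρ ^ 2 + s ^ 2 = 1)
    {p N : ℕ} {f : ℂ → ℂ} (hf : PoleLE p f) (hpN : p < N) :
    Real.circleAverage (fun ζ => f ζ / leftAmp ρ N ζ) 0 1 = 0 := by
  obtain ⟨g, hg, e⟩ := hf.mono (Nat.le_sub_one_of_lt hpN)
  refine Eq.trans ?_ (circleAverage_mul_div_scatPair hρ hs hρs hg N)
  apply Real.circleAverage_congr_sphere
  intro ζ hζ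
  have hζ1 : ‖ζ‖ = 1 := by simpa using hζ
  have h0 : ζ ≠ 0 := by rintro rfl; simp at hζ1
  beta_reduce
  rw [(scatPair_eq hρ h0 N).2, ← e ζ h0, ← mul_assoc, ← pow_succ', Nat.sub_add_cancel (by omega),
    mul_div_mul_left _ _ (pow_ne_zero _ h0)]

theorem continuousOn_div_leftAmp {ρ s : ℝ} (hρ : 0 < ρ) (hs : 0 ≤ s) (hρs : ρ ^ 2 + s ^ 2 = 1)
    {p : ℕ} (N : ℕ) {f : ℂ → ℂ} (hf : PoleLE p f) :
    ContinuousOn (fun ζ => f ζ / leftAmp ρ N ζ) (Metric.sphere 0 |1|) :=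
  hf.continuousOn.div (poleLE_leftAmp hρ N).continuousOn fun ζ hζ =>
    leftAmp_ne_zero hρ hs hρs (by simpa using hζ) N

theorem leftAmpConj_ne_zero {ρ s : ℝ} (hρ : 0 < ρ) (hs : 0 ≤ s) (hρs : ρ ^ 2 + s ^ 2 = 1) {ζ : ℂ}
    (hζ : ‖ζ‖ = 1) (k : ℕ) : leftAmpConj ρ k ζ ≠ 0 := by
  rw [← conj_leftAmp hζ]
  simpa using leftAmp_ne_zero hρ hs hρs hζ k

theorem continuousOn_div_leftAmp_mul_conj {ρ s : ℝ} (hρ : 0 < ρ) (hs : 0 ≤ s)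
    (hρs : ρ ^ 2 + s ^ 2 = 1) {p : ℕ} (N : ℕ) {f : ℂ → ℂ} (hf : PoleLE p f) :
    ContinuousOn (fun ζ => f ζ / (leftAmp ρ N ζ * leftAmpConj ρ N ζ)) (Metric.sphere 0 |1|) := by
  have h1 := (poleLE_leftAmp hρ N).continuousOn
  have h2 : ContinuousOn (leftAmpConj ρ N) (Metric.sphere 0 |1|) :=
    (Complex.continuous_conj.comp_continuousOn h1).congr fun ζ hζ =>
      (conj_leftAmp (by simpa using hζ) N).symm
  exact hf.continuousOn.div (h1.mul h2) fun ζ hζ => mul_ne_zero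
    (leftAmp_ne_zero hρ hs hρs (by simpa using hζ) N)
    (leftAmpConj_ne_zero hρ hs hρs (by simpa using hζ) N)

/-! ### The third-order recurrence for averages of quadratic forms -/

theorem leftAmp_sub_conj {ρ : ℝ} (k : ℤ) (ζ : ℂ) :
    leftAmp ρ k ζ - leftAmpConj ρ k ζ = -(ζ - ζ⁻¹) / ρ * chebV ρ k ζ := by
  rw [leftAmp, leftAmpConj]
  ring

theorem leftAmp_add_conj {ρ : ℝ} (k : ℤ) (ζ : ℂ) :
    leftAmp ρ k ζ + leftAmpConj ρ k ζ = chebV ρ (k + 1) ζ - chebV ρ (k - 1) ζ := by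
  rw [leftAmp, leftAmpConj, chebV_add_one]
  ring

/-- `2 U_j` as a combination of `T_N` and `U_N`, by the addition formula. -/
theorem two_mul_chebV (ρ : ℝ) (N j : ℤ) (ζ : ℂ) :
    2 * chebV ρ j ζ
      = chebV ρ N ζ * (chebV ρ (N - j + 1) ζ - chebV ρ (N - j - 1) ζ)
        - (chebV ρ (N + 1) ζ - chebV ρ (N - 1) ζ) * chebV ρ (N - j) ζ := by
  have h1 := chebV_add ρ N (-(N - j)) ζ
  have h2 := chebV_add ρ (-(N - j)) N ζ
  rw [show N + -(N - j) = j by ring, show -(N - j) - 1 = -(N - j + 1) by ring, chebV_neg,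
    chebV_neg] at h1
  rw [show -(N - j) + N = j by ring, show -(N - j) + 1 = -(N - j - 1) by ring, chebV_neg,
    chebV_neg] at h2
  linear_combination h1 + h2

/-- The numerator is a sum `G ȳ + Ḡ y`, where `y = leftAmp N` and `G` has a pole of order less
than `N` at `0`; dividing by `y ȳ` leaves the real part of a holomorphic function that vanishes
at `0`. -/
theorem circleAverage_sq_mul_chebV {ρ s : ℝ} (hρ : 0 < ρ) (hs : 0 ≤ s) (hρs : ρ ^ 2 + s ^ 2 = 1)
    {q N : ℕ} {j : ℤ} {e : ℂ → ℂ} (he : PoleLE q e)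
    (hec : ∀ ζ : ℂ, ‖ζ‖ = 1 → conj (e ζ) = e ζ) (hq : q + 2 < N)
    (hj : q + 1 + ((N : ℤ) - j).natAbs < N) :
    Real.circleAverage (fun ζ => e ζ * ((ζ - ζ⁻¹) ^ 2 * chebV ρ j ζ)
      / (leftAmp ρ N ζ * leftAmpConj ρ N ζ)) 0 1 = 0 := by
  have hρ' : (ρ : ℂ) ≠ 0 := by exact_mod_cast hρ.ne'
  set i : ℤ := N - j with hi
  have hid : PoleLE 1 fun ζ : ℂ => ζ - ζ⁻¹ :=
    ((PoleLE.of_differentiable differentiable_id).mono zero_le_one).sub PoleLE.inv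
  have hG : PoleLE (N - 1) fun ζ => e ζ * ((ζ - ζ⁻¹) * (ρ * (chebV ρ (i + 1) ζ - chebV ρ (i - 1) ζ)
      - (ζ - ζ⁻¹) * chebV ρ i ζ)) := by
    have h1 : PoleLE (N - 1 - q - 1) fun ζ => ρ * (chebV ρ (i + 1) ζ - chebV ρ (i - 1) ζ) :=
      (((poleLE_chebV hρ _).mono (by omega)).sub
        ((poleLE_chebV hρ _).mono (by omega))).const_mul ρ
    have h2 : PoleLE (N - 1 - q - 1) fun ζ => (ζ - ζ⁻¹) * chebV ρ i ζ :=
      (hid.mul (poleLE_chebV hρ i)).mono (by omega)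
    exact (he.mul (hid.mul (h1.sub h2))).mono (by omega)
  have hz := circleAverage_div_leftAmp hρ hs hρs hG (by omega : N - 1 < N)
  have hc := continuousOn_div_leftAmp hρ hs hρs N hG
  set F : ℂ → ℂ := fun ζ => e ζ * ((ζ - ζ⁻¹) * (ρ * (chebV ρ (i + 1) ζ - chebV ρ (i - 1) ζ)
      - (ζ - ζ⁻¹) * chebV ρ i ζ)) / leftAmp ρ N ζ with hF
  have hsum : Real.circleAverage (fun ζ => (1 / 2 : ℂ) • (F ζ + conj (F ζ))) 0 1 = 0 := by
    have hcc : ContinuousOn (fun ζ => conj (F ζ)) (Metric.sphere 0 |1|) :=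
      Complex.continuous_conj.comp_continuousOn hc
    rw [Real.circleAverage_fun_smul, Real.circleAverage_fun_add hc.circleIntegrable'
      hcc.circleIntegrable', circleAverage_conj hc, hz]
    simp
  refine Eq.trans ?_ hsum
  apply Real.circleAverage_congr_sphere
  intro ζ hζ
  have hζ1 : ‖ζ‖ = 1 := by simpa using hζ
  have hy := leftAmp_ne_zero hρ hs hρs hζ1 N
  have hyc := leftAmpConj_ne_zero hρ hs hρs hζ1 N
  have e1 := leftAmp_sub_conj (ρ := ρ) N ζ
  have e2 := leftAmp_add_conj (ρ := ρ) N ζ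
  have e3 := two_mul_chebV ρ N j ζ
  rw [← hi] at e3
  simp only [hF, map_div₀, map_mul, map_sub, map_inv₀, conj_leftAmp hζ1, conj_chebV hζ1,
    conj_eq_inv_of_norm_one hζ1, Complex.conj_ofReal, hec ζ hζ1, inv_inv, smul_eq_mul]
  rw [div_add_div _ _ hy hyc, mul_div, div_left_inj' (mul_ne_zero hy hyc)]
  have e1' : chebV ρ N ζ * (ζ - ζ⁻¹) = -ρ * (leftAmp ρ N ζ - leftAmpConj ρ N ζ) := by
    rw [e1]; field_simp
  linear_combination (1 / 2) * e ζ * (ζ - ζ⁻¹) ^ 2 * e3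
    + (1 / 2) * e ζ * (ζ - ζ⁻¹) * (chebV ρ (i + 1) ζ - chebV ρ (i - 1) ζ) * e1'
    + (1 / 2) * e ζ * (ζ - ζ⁻¹) ^ 2 * chebV ρ i ζ * e2

/-- The squared modulus on the unit circle of `lam V_{k+1} + nu ζ V_k`. -/
def quadForm (ρ : ℝ) (lam nu : ℂ) (k : ℤ) (ζ : ℂ) : ℂ :=
  (lam * chebV ρ (k + 1) ζ + nu * ζ * chebV ρ k ζ)
    * (conj lam * chebV ρ (k + 1) ζ + conj nu * ζ⁻¹ * chebV ρ k ζ)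

theorem poleLE_quadForm {ρ : ℝ} (hρ : 0 < ρ) (lam nu : ℂ) (k : ℤ) :
    ∃ p, PoleLE p (quadForm ρ lam nu k) := by
  have h1 := poleLE_chebV hρ (k + 1)
  have h2 := poleLE_chebV hρ k
  have hid : PoleLE 0 fun ζ : ℂ => ζ := PoleLE.of_differentiable differentiable_id
  set M := (k + 1).natAbs + k.natAbs + 1
  have a1 := ((h1.const_mul lam).mono (q := M) (by omega)).add
    (((hid.const_mul nu).mul h2).mono (by omega))
  have a2 := ((h1.const_mul (conj lam)).mono (q := M) (by omega)).add
    (((PoleLE.inv.const_mul (conj nu)).mul h2).mono (by omega))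
  exact ⟨_, a1.mul a2⟩

/-- Pointwise, `quadForm k` obeys a third-order recurrence with coefficient `X² - 1`, where
`X = (ζ + ζ⁻¹) / ρ`. Replacing `X²` by `4 / ρ²` leaves an error `(ζ - ζ⁻¹)² / ρ²` times Chebyshev
values. -/
theorem quadForm_recurrence {ρ : ℝ} (hρ : 0 < ρ) (lam nu : ℂ) (k : ℤ) {ζ : ℂ} (hζ : ζ ≠ 0) :
    quadForm ρ lam nu (k + 3) ζ - (4 / ρ ^ 2 - 1) * quadForm ρ lam nu (k + 2) ζ
      + (4 / ρ ^ 2 - 1) * quadForm ρ lam nu (k + 1) ζ - quadForm ρ lam nu k ζ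
    = (ζ - ζ⁻¹) ^ 2 / ρ ^ 2 * (lam * conj lam * chebV ρ (2 * k + 5) ζ
        + nu * conj nu * chebV ρ (2 * k + 3) ζ
        + (lam * conj nu * ζ⁻¹ + conj lam * nu * ζ) * chebV ρ (2 * k + 4) ζ) := by
  have hρ' : (ρ : ℂ) ≠ 0 := by exact_mod_cast hρ.ne'
  have r2 := chebV_add_one ρ (k + 1) ζ
  have r3 := chebV_add_one ρ (k + 2) ζ
  have r4 := chebV_add_one ρ (k + 3) ζ
  have d5 := chebV_add ρ (k + 2) (k + 3) ζ
  have d3 := chebV_add ρ (k + 1) (k + 2) ζ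
  have d4 := chebV_add ρ (k + 2) (k + 2) ζ
  rw [show k + 1 + 1 = k + 2 by ring, show k + 1 - 1 = k by ring] at r2
  rw [show k + 2 + 1 = k + 3 by ring, show k + 2 - 1 = k + 1 by ring] at r3
  rw [show k + 3 + 1 = k + 4 by ring, show k + 3 - 1 = k + 2 by ring] at r4
  rw [show k + 2 + (k + 3) = 2 * k + 5 by ring, show k + 2 + 1 = k + 3 by ring,
    show k + 3 - 1 = k + 2 by ring] at d5
  rw [show k + 1 + (k + 2) = 2 * k + 3 by ring, show k + 1 + 1 = k + 2 by ring,
    show k + 2 - 1 = k + 1 by ring] at d3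
  rw [show k + 2 + (k + 2) = 2 * k + 4 by ring, show k + 2 + 1 = k + 3 by ring,
    show k + 2 - 1 = k + 1 by ring] at d4
  simp only [quadForm, show k + 3 + 1 = k + 4 by ring, show k + 2 + 1 = k + 3 by ring,
    show k + 1 + 1 = k + 2 by ring, d3, d4, d5, r4, r3, r2]
  have hX : (4 : ℂ) / ρ ^ 2 = ((ζ + ζ⁻¹) / ρ) ^ 2 - (ζ - ζ⁻¹) ^ 2 / ρ ^ 2 := by
    field_simp
    ring
  have hZ : ζ * ζ⁻¹ = 1 := mul_inv_cancel₀ hζ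
  rw [hX]
  generalize chebV ρ k ζ = v0
  generalize chebV ρ (k + 1) ζ = v1
  generalize (ζ + ζ⁻¹) / (ρ : ℂ) = X
  generalize (ζ - ζ⁻¹) ^ 2 / (ρ : ℂ) ^ 2 = E
  generalize conj lam = lamc
  generalize conj nu = nuc
  linear_combination nu * nuc * ((X * (X * v1 - v0) - v1) ^ 2
    - (X ^ 2 - E - 1) * (X * v1 - v0) ^ 2 + (X ^ 2 - E - 1) * v1 ^ 2 - v0 ^ 2) * hZ

/-- The circle average of `quadForm k / |leftAmp N|²`. -/
def quadAverage (ρ : ℝ) (N : ℕ) (lam nu : ℂ) (k : ℤ) : ℂ :=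
  Real.circleAverage (fun ζ => quadForm ρ lam nu k ζ / (leftAmp ρ N ζ * leftAmpConj ρ N ζ)) 0 1

theorem quadAverage_recurrence {ρ s : ℝ} (hρ : 0 < ρ) (hs : 0 ≤ s) (hρs : ρ ^ 2 + s ^ 2 = 1)
    {N : ℕ} (lam nu : ℂ) {k : ℤ} (hk : 0 ≤ k) (hkN : k + 4 ≤ N) :
    quadAverage ρ N lam nu (k + 3) - (4 / ρ ^ 2 - 1) * quadAverage ρ N lam nu (k + 2)
      + (4 / ρ ^ 2 - 1) * quadAverage ρ N lam nu (k + 1) - quadAverage ρ N lam nu k = 0 := by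
  have hρ' : (ρ : ℂ) ≠ 0 := by exact_mod_cast hρ.ne'
  set e : ℂ → ℂ := fun ζ => lam * conj nu * ζ⁻¹ + conj lam * nu * ζ with he
  have heP : PoleLE 1 e := (PoleLE.inv.const_mul _).add
    (((PoleLE.of_differentiable differentiable_id).const_mul _).mono zero_le_one)
  have hec : ∀ ζ : ℂ, ‖ζ‖ = 1 → conj (e ζ) = e ζ := by
    intro ζ hζ
    simp only [he, map_add, map_mul, map_inv₀, conj_eq_inv_of_norm_one hζ, Complex.conj_conj,
      inv_inv]
    ring
  have z5 := circleAverage_sq_mul_chebV hρ hs hρs (j := 2 * k + 5) (N := N)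
    (PoleLE.const 1) (by simp) (by omega) (by omega)
  have z3 := circleAverage_sq_mul_chebV hρ hs hρs (j := 2 * k + 3) (N := N)
    (PoleLE.const 1) (by simp) (by omega) (by omega)
  have z4 := circleAverage_sq_mul_chebV hρ hs hρs (j := 2 * k + 4) (N := N)
    heP hec (by omega) (by omega)
  have hcont : ∀ (f : ℂ → ℂ) (j : ℤ) (p : ℕ), PoleLE p f → ContinuousOn (fun ζ =>
      f ζ * ((ζ - ζ⁻¹) ^ 2 * chebV ρ j ζ) / (leftAmp ρ N ζ * leftAmpConj ρ N ζ))
      (Metric.sphere 0 |1|) := by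
    intro f j p hf
    have hid : PoleLE 1 fun ζ : ℂ => ζ - ζ⁻¹ :=
      ((PoleLE.of_differentiable differentiable_id).mono zero_le_one).sub PoleLE.inv
    have h := hf.mul ((hid.mul hid).mul (poleLE_chebV hρ j))
    simp only [← sq] at h
    exact continuousOn_div_leftAmp_mul_conj hρ hs hρs N h
  have hcontQ : ∀ j : ℤ, ContinuousOn (fun ζ => quadForm ρ lam nu j ζ
      / (leftAmp ρ N ζ * leftAmpConj ρ N ζ)) (Metric.sphere 0 |1|) := fun j =>
    continuousOn_div_leftAmp_mul_conj hρ hs hρs N (poleLE_quadForm hρ lam nu j).choose_spec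
  have hmain := sum_mul_circleAverage_eq_zero
    ![1, -(4 / ρ ^ 2 - 1 : ℂ), (4 / ρ ^ 2 - 1 : ℂ), -1, -(lam * conj lam / ρ ^ 2),
      -(nu * conj nu / ρ ^ 2), -(1 / ρ ^ 2 : ℂ)]
    ![fun ζ => quadForm ρ lam nu (k + 3) ζ / (leftAmp ρ N ζ * leftAmpConj ρ N ζ),
      fun ζ => quadForm ρ lam nu (k + 2) ζ / (leftAmp ρ N ζ * leftAmpConj ρ N ζ),
      fun ζ => quadForm ρ lam nu (k + 1) ζ / (leftAmp ρ N ζ * leftAmpConj ρ N ζ),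
      fun ζ => quadForm ρ lam nu k ζ / (leftAmp ρ N ζ * leftAmpConj ρ N ζ),
      fun ζ => 1 * ((ζ - ζ⁻¹) ^ 2 * chebV ρ (2 * k + 5) ζ)
        / (leftAmp ρ N ζ * leftAmpConj ρ N ζ),
      fun ζ => 1 * ((ζ - ζ⁻¹) ^ 2 * chebV ρ (2 * k + 3) ζ)
        / (leftAmp ρ N ζ * leftAmpConj ρ N ζ),
      fun ζ => e ζ * ((ζ - ζ⁻¹) ^ 2 * chebV ρ (2 * k + 4) ζ)
        / (leftAmp ρ N ζ * leftAmpConj ρ N ζ)]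
    (by
      intro i
      fin_cases i
      · exact hcontQ _
      · exact hcontQ _
      · exact hcontQ _
      · exact hcontQ _
      · exact hcont _ _ _ (PoleLE.const 1)
      · exact hcont _ _ _ (PoleLE.const 1)
      · exact hcont _ _ _ heP)
    (by
      intro ζ hζ
      have h0 : ζ ≠ 0 := by rintro rfl; simp at hζ
      have hr := quadForm_recurrence hρ lam nu k h0
      simp only [Fin.sum_univ_succ, Fin.sum_univ_zero, Matrix.cons_val_zero, Matrix.cons_val_succ]
      linear_combination hr / (leftAmp ρ N ζ * leftAmpConj ρ N ζ))
  simp only [Fin.sum_univ_succ, Fin.sum_univ_zero, Matrix.cons_val_zero, Matrix.cons_val_succ,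
    z5, z3, z4] at hmain
  simp only [quadAverage]
  linear_combination hmain

/-! ### The mean square of the reflection coefficient -/

theorem exists_eq_sq_sub_one_mul {F : ℂ → ℂ} (hF : Differentiable ℂ F) (h1 : F 1 = 0)
    (h2 : F (-1) = 0) : ∃ G : ℂ → ℂ, Differentiable ℂ G ∧ ∀ ζ, F ζ = (ζ ^ 2 - 1) * G ζ := by
  have hd : ∀ (f : ℂ → ℂ) (c : ℂ), Differentiable ℂ f → Differentiable ℂ (dslope f c) := by
    intro f c hf
    rw [← differentiableOn_univ] at hf ⊢
    exact (Complex.differentiableOn_dslope univ_mem).2 hf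
  have e1 : ∀ ζ, F ζ = (ζ - 1) * dslope F 1 ζ := fun ζ => by
    simpa [h1] using (sub_smul_dslope F 1 ζ).symm
  have h3 : dslope F 1 (-1) = 0 := by
    have := e1 (-1)
    rw [h2] at this
    rcases mul_eq_zero.1 this.symm with h | h
    · norm_num at h
    · exact h
  have e2 : ∀ ζ, dslope F 1 ζ = (ζ + 1) * dslope (dslope F 1) (-1) ζ := fun ζ => by
    simpa [h3] using (sub_smul_dslope (dslope F 1) (-1) ζ).symm
  exact ⟨_, hd _ (-1) (hd F 1 hF), fun ζ => by rw [e1, e2]; ring⟩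

/-- The reflection function `g = V_N / y`, `y = leftAmp N`, satisfies
`|g|² (ζ - ζ⁻¹) = ρ (g - ḡ)` on the unit circle, and `g - g(1) ζ` is divisible by `ζ² - 1`, so
`|g|²` is the constant `ρ g(1)` plus the real part of a holomorphic function vanishing at `0`. -/
theorem circleAverage_chebV_sq {ρ s : ℝ} (hρ : 0 < ρ) (hs : 0 ≤ s) (hρs : ρ ^ 2 + s ^ 2 = 1)
    (N : ℕ) :
    Real.circleAverage (fun ζ => chebV ρ N ζ ^ 2 / (leftAmp ρ N ζ * leftAmpConj ρ N ζ)) 0 1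
      = ρ * (chebV ρ N 1 / leftAmp ρ N 1) := by
  have hρ' : (ρ : ℂ) ≠ 0 := by exact_mod_cast hρ.ne'
  have hy1 := leftAmp_ne_zero hρ hs hρs (norm_one (α := ℂ)) N
  set κ : ℂ := chebV ρ N 1 / leftAmp ρ N 1 with hκ
  have hκc : conj κ = κ := by
    rw [hκ, map_div₀, conj_chebV norm_one, conj_leftAmp norm_one]
    simp [leftAmp, leftAmpConj]
  have hA := (differentiable_scatPair ρ N).1
  have hD := (differentiable_scatPair ρ N).2
  have hF1 : (scatPair ρ N 1).1 - κ * 1 * (scatPair ρ N 1).2 = 0 := by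
    rw [(scatPair_eq hρ one_ne_zero N).1, (scatPair_eq hρ one_ne_zero N).2, hκ]
    field_simp
    simp
  obtain ⟨G, hG, hFG⟩ := exists_eq_sq_sub_one_mul
    (F := fun ζ => (scatPair ρ N ζ).1 - κ * ζ * (scatPair ρ N ζ).2) (by fun_prop) hF1
    (by
      rw [(scatPair_neg ρ N 1).1, (scatPair_neg ρ N 1).2]
      linear_combination -hF1)
  set h : ℂ → ℂ := fun ζ => ζ * G ζ / (scatPair ρ N ζ).2 with hh
  have hz : Real.circleAverage h 0 1 = 0 := circleAverage_mul_div_scatPair hρ hs hρs hG N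
  have hc : ContinuousOn h (Metric.sphere 0 |1|) :=
    (continuous_id.mul hG.continuous).continuousOn.div hD.continuous.continuousOn fun ζ hζ =>
      (scatPair_bound hρ hs hρs (by simp at hζ; exact hζ.le) N).2
  have hcc : ContinuousOn (fun ζ => conj (h ζ)) (Metric.sphere 0 |1|) :=
    Complex.continuous_conj.comp_continuousOn hc
  have hadd : ContinuousOn (fun ζ => h ζ + conj (h ζ)) (Metric.sphere 0 |1|) := hc.add hcc
  have hsum : Real.circleAverage (fun ζ => (ρ : ℂ) • (κ + (h ζ + conj (h ζ)))) 0 1 = ρ * κ := by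
    rw [Real.circleAverage_fun_smul, Real.circleAverage_fun_add
      (circleIntegrable_const _ _ _) hadd.circleIntegrable',
      Real.circleAverage_fun_add hc.circleIntegrable' hcc.circleIntegrable',
      circleAverage_conj hc, hz, Real.circleAverage_const]
    simp
  rw [← hsum]
  refine Real.circleAverage_congr_codiscreteWithin ?_ one_ne_zero
  have hfin : ({1, -1} : Set ℂ)ᶜ ∈ codiscreteWithin (Metric.sphere (0 : ℂ) |1|) :=
    compl_finite_mem_codiscreteWithin (by simp)
  filter_upwards [hfin, self_mem_codiscreteWithin _] with ζ hζ hζs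
  have hζ1 : ‖ζ‖ = 1 := by simpa using hζs
  have h0 : ζ ≠ 0 := by rintro rfl; simp at hζ1
  have hne : ζ - ζ⁻¹ ≠ 0 := by
    intro h
    have : (ζ - 1) * (ζ + 1) = 0 := by
      field_simp at h
      linear_combination h
    rcases mul_eq_zero.1 this with h | h
    · exact hζ (Or.inl (by linear_combination h))
    · exact hζ (Or.inr (by rw [Set.mem_singleton_iff]; linear_combination h))
  have hy := leftAmp_ne_zero hρ hs hρs hζ1 N
  have hyc := leftAmpConj_ne_zero hρ hs hρs hζ1 N
  have e1 : chebV ρ N ζ / leftAmp ρ N ζ - κ * ζ = (ζ - ζ⁻¹) * h ζ := by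
    have hN := pow_ne_zero N h0
    have h3 := hFG ζ
    beta_reduce at h3
    rw [(scatPair_eq hρ h0 N).1, (scatPair_eq hρ h0 N).2] at h3
    simp only [hh, (scatPair_eq hρ h0 N).2]
    field_simp
    linear_combination h3
  have e2 := congrArg conj e1
  simp only [map_sub, map_mul, map_div₀, conj_chebV hζ1, conj_leftAmp hζ1, hκc, map_inv₀,
    conj_eq_inv_of_norm_one hζ1, inv_inv] at e2
  have e3 := leftAmp_sub_conj (ρ := ρ) N ζ
  apply mul_left_cancel₀ hne
  have e4 : (ζ - ζ⁻¹) * (chebV ρ N ζ ^ 2 / (leftAmp ρ N ζ * leftAmpConj ρ N ζ))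
      = ρ * (chebV ρ N ζ / leftAmp ρ N ζ - chebV ρ N ζ / leftAmpConj ρ N ζ) := by
    field_simp at e3 ⊢
    linear_combination chebV ρ N ζ * e3
  rw [e4, smul_eq_mul]
  linear_combination (ρ : ℂ) * (e1 - e2)

/-! ### Removing the phases of the coin -/

/-- The coin `U` is obtained from a rotation with entries `ρ`, `s` by the phases `δ`, `u`, `η`;
`δ ^ 2` is the determinant of `U`. -/
structure CoinPhases (U : Matrix (Fin 2) (Fin 2) ℂ) (ρ s : ℝ) (δ u η : ℂ) : Prop where
  rho_pos : 0 < ρ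
  s_nonneg : 0 ≤ s
  sq_add_sq : ρ ^ 2 + s ^ 2 = 1
  norm_delta : ‖δ‖ = 1
  norm_u : ‖u‖ = 1
  norm_eta : ‖η‖ = 1
  entry_zero_zero : U 0 0 * η = δ * ρ
  entry_zero_one : U 0 1 = s * δ * u
  entry_one_zero : U 1 0 = -s * δ * conj u
  entry_one_one : U 1 1 = η * δ * ρ

theorem exists_coinPhases {U : Matrix (Fin 2) (Fin 2) ℂ}
    (hU : U ∈ Matrix.unitaryGroup (Fin 2) ℂ) (ha : U 0 0 ≠ 0) :
    ∃ δ u η : ℂ, CoinPhases U ‖U 0 0‖ ‖U 0 1‖ δ u η := by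
  have h := Matrix.mem_unitaryGroup_iff.1 hU
  have h00 := congrFun (congrFun h 0) 0
  have h10 := congrFun (congrFun h 1) 0
  simp only [Matrix.mul_apply, Fin.sum_univ_two, Matrix.star_apply, RCLike.star_def,
    Matrix.one_apply_eq, Matrix.one_apply_ne (one_ne_zero : (1 : Fin 2) ≠ 0)] at h00 h10
  set a := U 0 0
  set b := U 0 1
  set Δ := U.det with hΔ
  rw [Matrix.det_fin_two] at hΔ
  have hΔn : ‖Δ‖ = 1 := by
    have h1 := (Unitary.mem_iff.1 (Matrix.det_of_mem_unitary hU)).2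
    rw [RCLike.star_def, Complex.mul_conj'] at h1
    have h2 : ‖Δ‖ ^ 2 = 1 := by exact_mod_cast h1
    exact (pow_eq_one_iff_of_nonneg (norm_nonneg _) two_ne_zero).1 h2
  have hd : U 1 1 = Δ * conj a := by rw [hΔ]; linear_combination -U 1 1 * h00 + b * h10
  have hc : U 1 0 = -Δ * conj b := by rw [hΔ]; linear_combination -U 1 0 * h00 + a * h10
  obtain ⟨δ, hδ⟩ := IsAlgClosed.exists_pow_nat_eq Δ two_pos
  have hδn : ‖δ‖ = 1 := by
    rw [← hδ, norm_pow] at hΔn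
    exact (pow_eq_one_iff_of_nonneg (norm_nonneg _) two_ne_zero).1 hΔn
  have hδ0 : δ ≠ 0 := by rintro rfl; simp at hδn
  have hδc : δ * conj δ = 1 := by rw [Complex.mul_conj', hδn]; simp
  have han : (‖a‖ : ℂ) ≠ 0 := by exact_mod_cast norm_ne_zero_iff.2 ha
  obtain ⟨u, hu, hbu⟩ : ∃ u : ℂ, ‖u‖ = 1 ∧ b = ‖b‖ * δ * u := by
    by_cases hb : b = 0
    · exact ⟨1, norm_one, by simp [hb]⟩
    · have hbn : (‖b‖ : ℂ) ≠ 0 := by exact_mod_cast norm_ne_zero_iff.2 hb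
      exact ⟨b / (‖b‖ * δ), by simp [hδn, hb], by field_simp⟩
  refine ⟨δ, u, δ * ‖a‖ / a, norm_pos_iff.2 ha, norm_nonneg _, ?_, hδn, hu, ?_, ?_, hbu, ?_, ?_⟩
  · rw [Complex.mul_conj', Complex.mul_conj'] at h00
    exact_mod_cast h00
  · simp [hδn, ha]
  · change a * _ = _
    field_simp
  · have hbc : conj b = ‖b‖ * conj δ * conj u := by
      conv_lhs => rw [hbu]
      simp
    rw [hc, ← hδ, hbc]
    linear_combination -δ * ‖b‖ * conj u * hδc
  · rw [hd, ← hδ]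
    field_simp
    rw [mul_comm, Complex.mul_conj']

/-! ### Generating functions of the absorption amplitudes -/

variable {U : Matrix (Fin 2) (Fin 2) ℂ} {ρ s : ℝ} {δ u η : ℂ}

/-- The numerator of the generating function, over time, of the amplitude with which the walk
started in `|x⟩|R⟩` is absorbed at `0`, for barriers at `0` and `N + 1`. The common denominator
is `leftAmp ρ N`. -/
def rightNum (ρ s : ℝ) (u η : ℂ) (N : ℕ) (x : ℤ) (ζ : ℂ) : ℂ :=
  conj u * η ^ (x - 1) * (-(s / ρ)) * chebV ρ (N + 1 - x) ζ

/-- The numerator of the generating function of the amplitude with which the walk started in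
`|x⟩|L⟩` is absorbed at `0`, for barriers at `0` and `N + 1`. -/
def leftNum (ρ : ℝ) (η : ℂ) (N : ℕ) (x : ℤ) (ζ : ℂ) : ℂ :=
  η ^ x * leftAmp ρ (N - x) ζ

theorem CoinPhases.rightNum_eq (h : CoinPhases U ρ s δ u η) (N : ℕ) (x : ℤ) {ζ : ℂ} (hζ : ζ ≠ 0) :
    rightNum ρ s u η N x ζ = conj δ * ζ * (U 0 0 * rightNum ρ s u η N (x + 1) ζ
      + U 1 0 * leftNum ρ η N (x - 1) ζ) := by
  have hρ : (ρ : ℂ) ≠ 0 := by exact_mod_cast h.rho_pos.ne'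
  have hη : η ≠ 0 := by rintro rfl; simpa using h.norm_eta
  have hδ : conj δ * δ = 1 := by rw [Complex.conj_mul', h.norm_delta]; simp
  have ha : U 0 0 = δ * ρ / η := by rw [eq_div_iff hη, h.entry_zero_zero]
  have hr := chebV_add_one ρ (N + 1 - x) ζ
  rw [rightNum, rightNum, leftNum, leftAmp, ha, h.entry_one_zero,
    show (N : ℤ) + 1 - (x + 1) = N + 1 - x - 1 by ring,
    show (N : ℤ) - (x - 1) = N + 1 - x by ring, hr, show x + 1 - 1 = x - 1 + 1 by ring,
    zpow_add_one₀ hη]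
  field_simp
  linear_combination
    (conj u * s * chebV ρ (N + 1 - x) ζ) * hδ

theorem CoinPhases.leftNum_eq (h : CoinPhases U ρ s δ u η) (N : ℕ) (x : ℤ) {ζ : ℂ} (hζ : ζ ≠ 0) :
    leftNum ρ η N x ζ = conj δ * ζ * (U 0 1 * rightNum ρ s u η N (x + 1) ζ
      + U 1 1 * leftNum ρ η N (x - 1) ζ) := by
  have hρ : (ρ : ℂ) ≠ 0 := by exact_mod_cast h.rho_pos.ne'
  have hη : η ≠ 0 := by rintro rfl; simpa using h.norm_eta
  have hδ : conj δ * δ = 1 := by rw [Complex.conj_mul', h.norm_delta]; simp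
  have hu : u * conj u = 1 := by rw [Complex.mul_conj', h.norm_u]; simp
  have hs : (s : ℂ) ^ 2 = 1 - ρ ^ 2 := by
    have : (ρ ^ 2 + s ^ 2 : ℂ) = 1 := by exact_mod_cast h.sq_add_sq
    linear_combination this
  have hr := chebV_add_one ρ (N - x + 1) ζ
  rw [add_sub_cancel_right] at hr
  rw [rightNum, leftNum, leftNum, leftAmp, leftAmp, h.entry_zero_one, h.entry_one_one,
    show (N : ℤ) + 1 - (x + 1) = N - x by ring,
    show (N : ℤ) - (x - 1) = N - x + 1 by ring, hr, add_sub_cancel_right,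
    show x = x - 1 + 1 by ring, zpow_add_one₀ hη, sub_add_cancel]
  have e1 : conj δ * ζ * (s * δ * u * (conj u * (η ^ (x - 1) * η) * (-(s / ρ))
      * chebV ρ (N - x) ζ)) = -(ζ * (η ^ (x - 1) * η) * (s ^ 2 / ρ) * chebV ρ (N - x) ζ) := by
    linear_combination -(ζ * (η ^ (x - 1) * η) * (s ^ 2 / ρ) * chebV ρ (N - x) ζ)
      * (u * conj u * hδ + hu)
  rw [mul_add, e1, hs]
  field_simp
  linear_combination -(ρ * chebV ρ (N - x + 1) ζ - ρ ^ 2 * ζ * chebV ρ (N - x) ζ) * hδ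

/-- The numerator of `pairing`. -/
def pairingNum (ρ s : ℝ) (u η : ℂ) (N : ℕ) (ψ : WalkState) (ζ : ℂ) : ℂ :=
  ∑ x ∈ Finset.Ioo (0 : ℤ) (N + 1),
    (ψ (x, 0) * rightNum ρ s u η N x ζ + ψ (x, 1) * leftNum ρ η N x ζ)

/-- The generating function, over time, of the amplitude with which the walk started in `ψ` is
absorbed at `0`, for barriers at `0` and `N + 1`, on the unit circle: `∑ t, aₜ (conj δ * ζ) ^ (t + 1)`,
where `aₜ` is the amplitude of absorption in step `t + 1`. -/
def pairing (ρ s : ℝ) (u η : ℂ) (N : ℕ) (ψ : WalkState) (ζ : ℂ) : ℂ :=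
  pairingNum ρ s u η N ψ ζ / leftAmp ρ N ζ

theorem CoinPhases.pairing_eq (h : CoinPhases U ρ s δ u η) {N : ℕ} (hN : 1 ≤ N) {ψ : WalkState}
    (hψ : Confined (N + 1) ψ) {ζ : ℂ} (hζ : ‖ζ‖ = 1) :
    pairing ρ s u η N ψ ζ
      = conj δ * ζ * (walkOp U ψ (0, 1) + pairing ρ s u η N (stepOp U (N + 1) ψ) ζ) := by
  have h0 : ζ ≠ 0 := by rintro rfl; simp at hζ
  have hy := leftAmp_ne_zero h.rho_pos h.s_nonneg h.sq_add_sq hζ N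
  have hn : (2 : ℤ) ≤ N + 1 := by omega
  have hR := sum_Ioo_add_one hn (fun x => walkOp U ψ (x, 0) * rightNum ρ s u η N x ζ)
  have hL := sum_Ioo_sub_one hn (fun x => walkOp U ψ (x, 1) * leftNum ρ η N x ζ)
  have e1 : walkOp U ψ (1, 0) = 0 := by
    rw [walkOp_apply_zero, hψ _ 0 (by omega), hψ _ 1 (by omega)]; simp
  have e2 : walkOp U ψ ((N : ℤ) + 1 - 1, 1) = 0 := by
    rw [walkOp_apply_one, hψ _ 0 (by omega), hψ _ 1 (by omega)]; simp
  have e3 : rightNum ρ s u η N (N + 1) ζ = 0 := by simp [rightNum, chebV_zero]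
  have e4 : leftNum ρ η N 0 ζ = leftAmp ρ N ζ := by simp [leftNum]
  simp only [e1, e2, e3, e4, zero_mul, mul_zero, add_zero, sub_zero] at hR hL
  have hstep : pairingNum ρ s u η N (stepOp U (N + 1) ψ) ζ
      = ∑ x ∈ Finset.Ioo (0 : ℤ) (N + 1), walkOp U ψ (x, 0) * rightNum ρ s u η N x ζ
        + ∑ x ∈ Finset.Ioo (0 : ℤ) (N + 1), walkOp U ψ (x, 1) * leftNum ρ η N x ζ := by
    rw [pairingNum, ← Finset.sum_add_distrib]
    refine Finset.sum_congr rfl fun x hx => ?_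
    have := Finset.mem_Ioo.1 hx
    rw [stepOp_apply, stepOp_apply, if_neg (by omega), if_neg (by omega)]
  have hmain : pairingNum ρ s u η N ψ ζ
      = conj δ * ζ * (∑ x ∈ Finset.Ioo (0 : ℤ) (N + 1),
          walkOp U ψ (x + 1, 0) * rightNum ρ s u η N (x + 1) ζ
        + ∑ x ∈ Finset.Ioo (0 : ℤ) (N + 1),
          walkOp U ψ (x - 1, 1) * leftNum ρ η N (x - 1) ζ) := by
    rw [pairingNum, ← Finset.sum_add_distrib, Finset.mul_sum]
    refine Finset.sum_congr rfl fun x _ => ?_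
    rw [h.rightNum_eq N x h0, h.leftNum_eq N x h0, walkOp_apply_zero, walkOp_apply_one,
      add_sub_cancel_right, sub_add_cancel]
    ring
  rw [hR, hL] at hmain
  rw [pairing, pairing, hmain, hstep]
  field_simp
  ring

theorem PoleLE.sum {ι : Type*} {p : ℕ} (t : Finset ι) {f : ι → ℂ → ℂ}
    (hf : ∀ i ∈ t, PoleLE p (f i)) : PoleLE p fun ζ => ∑ i ∈ t, f i ζ := by
  classical
  induction t using Finset.induction_on with
  | empty => simpa using (PoleLE.const 0).mono (Nat.zero_le p)
  | insert a t ha ih =>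
    simp only [Finset.sum_insert ha]
    exact (hf a (Finset.mem_insert_self a t)).add
      (ih fun i hi => hf i (Finset.mem_insert_of_mem hi))

theorem poleLE_rightNum (hρ : 0 < ρ) {N : ℕ} {x : ℤ} (h0 : 0 < x) (hx : x < N + 1) :
    PoleLE (N - 1) (rightNum ρ s u η N x) :=
  ((poleLE_chebV hρ _).mono (by omega)).const_mul _

theorem poleLE_leftNum (hρ : 0 < ρ) {N : ℕ} {x : ℤ} (h0 : 0 < x) (hx : x < N + 1) :
    PoleLE (N - 1) (leftNum ρ η N x) := by
  have e : (N : ℤ) - x = ((N - x.toNat : ℕ) : ℤ) := by omega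
  have h := ((poleLE_leftAmp hρ (N - x.toNat)).mono (q := N - 1) (by omega)).const_mul (η ^ x)
  rw [← e] at h
  exact h

theorem poleLE_pairingNum (hρ : 0 < ρ) (N : ℕ) (ψ : WalkState) :
    PoleLE (N - 1) (pairingNum ρ s u η N ψ) := by
  refine PoleLE.sum _ fun x hx => ?_
  have := Finset.mem_Ioo.1 hx
  exact ((poleLE_rightNum hρ this.1 this.2).const_mul _).add
    ((poleLE_leftNum hρ this.1 this.2).const_mul _)

theorem CoinPhases.continuousOn_pairing (h : CoinPhases U ρ s δ u η) (N : ℕ) (ψ : WalkState) :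
    ContinuousOn (pairing ρ s u η N ψ) (Metric.sphere 0 |1|) :=
  continuousOn_div_leftAmp h.rho_pos h.s_nonneg h.sq_add_sq N (poleLE_pairingNum h.rho_pos N ψ)

theorem CoinPhases.circleAverage_pairing (h : CoinPhases U ρ s δ u η) {N : ℕ} (hN : 1 ≤ N)
    (ψ : WalkState) : Real.circleAverage (pairing ρ s u η N ψ) 0 1 = 0 :=
  circleAverage_div_leftAmp h.rho_pos h.s_nonneg h.sq_add_sq (poleLE_pairingNum h.rho_pos N ψ)
    (by omega)

/-! ### Absorption probabilities as circle averages -/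

/-- The squared `L²` norm of `pairing` on the unit circle. -/
def pairingEnergy (ρ s : ℝ) (u η : ℂ) (N : ℕ) (ψ : WalkState) : ℝ :=
  Real.circleAverage (fun ζ => ‖pairing ρ s u η N ψ ζ‖ ^ 2) 0 1

theorem CoinPhases.pairingEnergy_eq (h : CoinPhases U ρ s δ u η) {N : ℕ} (hN : 1 ≤ N)
    {ψ : WalkState} (hψ : Confined (N + 1) ψ) :
    pairingEnergy ρ s u η N ψ
      = ‖walkOp U ψ (0, 1)‖ ^ 2 + pairingEnergy ρ s u η N (stepOp U (N + 1) ψ) := by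
  set A := walkOp U ψ (0, 1)
  set B := pairing ρ s u η N (stepOp U (N + 1) ψ) with hB
  have hc : ContinuousOn B (Metric.sphere 0 |1|) := h.continuousOn_pairing N _
  have hcA : ContinuousOn (fun ζ => conj A * B ζ) (Metric.sphere 0 |1|) :=
    continuousOn_const.mul hc
  have hcR : ContinuousOn (fun ζ => 2 * (conj A * B ζ).re) (Metric.sphere 0 |1|) :=
    continuousOn_const.mul (Complex.continuous_re.comp_continuousOn hcA)
  have hcN : ContinuousOn (fun ζ => ‖B ζ‖ ^ 2) (Metric.sphere 0 |1|) := hc.norm.pow 2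
  have hcRN : ContinuousOn (fun ζ => 2 * (conj A * B ζ).re + ‖B ζ‖ ^ 2) (Metric.sphere 0 |1|) :=
    hcR.add hcN
  have hcross : Real.circleAverage (fun ζ => 2 * (conj A * B ζ).re) 0 1 = 0 := by
    have h1 : Real.circleAverage (fun ζ => conj A * B ζ) 0 1 = 0 := by
      have h2 := Real.circleAverage_fun_smul (a := conj A) (f := B) (c := 0) (R := 1)
      simp only [smul_eq_mul] at h2
      rw [h2, hB, h.circleAverage_pairing hN, mul_zero]
    have h3 : Real.circleAverage (fun ζ => (conj A * B ζ).re) 0 1 = 0 :=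
      (Complex.reCLM.circleAverage_comp_comm hcA.circleIntegrable').trans (by rw [h1]; simp)
    have h4 := Real.circleAverage_fun_smul (a := (2 : ℝ)) (f := fun ζ => (conj A * B ζ).re)
      (c := 0) (R := 1)
    simp only [smul_eq_mul] at h4
    rw [h4, h3, mul_zero]
  calc pairingEnergy ρ s u η N ψ
      = Real.circleAverage (fun ζ => ‖A‖ ^ 2 + (2 * (conj A * B ζ).re + ‖B ζ‖ ^ 2)) 0 1 := by
        apply Real.circleAverage_congr_sphere
        intro ζ hζ
        have hζ1 : ‖ζ‖ = 1 := by simpa using hζ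
        beta_reduce
        rw [h.pairing_eq hN hψ hζ1, norm_mul, norm_mul, Complex.norm_conj, h.norm_delta, hζ1,
          one_mul, one_mul, Complex.sq_norm, Complex.sq_norm, Complex.sq_norm, Complex.normSq_add,
          ← Complex.conj_re, map_mul, Complex.conj_conj]
        ring
    _ = _ := by
        rw [Real.circleAverage_fun_add (circleIntegrable_const _ _ _) hcRN.circleIntegrable',
          Real.circleAverage_fun_add hcR.circleIntegrable' hcN.circleIntegrable', hcross,
          Real.circleAverage_const, zero_add]
        rfl

theorem CoinPhases.exists_pairingEnergy_le (h : CoinPhases U ρ s δ u η) (N : ℕ) :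
    ∃ M : ℝ, ∀ ψ : WalkState, pairingEnergy ρ s u η N ψ
      ≤ ((∑ x ∈ Finset.Ioo (0 : ℤ) (N + 1), (‖ψ (x, 0)‖ + ‖ψ (x, 1)‖)) * M) ^ 2 := by
  have hcR : ∀ x ∈ Finset.Ioo (0 : ℤ) (N + 1), ContinuousOn
      (fun ζ => rightNum ρ s u η N x ζ / leftAmp ρ N ζ) (Metric.sphere 0 |1|) := fun x hx =>
    continuousOn_div_leftAmp h.rho_pos h.s_nonneg h.sq_add_sq N
      (poleLE_rightNum h.rho_pos (Finset.mem_Ioo.1 hx).1 (Finset.mem_Ioo.1 hx).2)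
  have hcL : ∀ x ∈ Finset.Ioo (0 : ℤ) (N + 1), ContinuousOn
      (fun ζ => leftNum ρ η N x ζ / leftAmp ρ N ζ) (Metric.sphere 0 |1|) := fun x hx =>
    continuousOn_div_leftAmp h.rho_pos h.s_nonneg h.sq_add_sq N
      (poleLE_leftNum h.rho_pos (Finset.mem_Ioo.1 hx).1 (Finset.mem_Ioo.1 hx).2)
  set w : ℤ → ℂ → ℝ := fun x ζ =>
    ‖rightNum ρ s u η N x ζ / leftAmp ρ N ζ‖ + ‖leftNum ρ η N x ζ / leftAmp ρ N ζ‖ with hw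
  obtain ⟨M, hM⟩ := (isCompact_sphere (0 : ℂ) |1|).exists_bound_of_continuousOn
    (f := fun ζ => ∑ x ∈ Finset.Ioo (0 : ℤ) (N + 1), w x ζ)
    (continuousOn_finsetSum _ fun x hx => (hcR x hx).norm.add (hcL x hx).norm)
  have hw0 : ∀ x ζ, 0 ≤ w x ζ := fun x ζ => by positivity
  refine ⟨M, fun ψ => Real.circleAverage_mono_on_of_le_circle
    ((h.continuousOn_pairing N ψ).norm.pow 2).circleIntegrable' fun ζ hζ => ?_⟩
  refine pow_le_pow_left₀ (norm_nonneg _) ?_ 2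
  rw [pairing, pairingNum, Finset.sum_div, Finset.sum_mul]
  refine (norm_sum_le _ _).trans (Finset.sum_le_sum fun x hx => ?_)
  have hwM : w x ζ ≤ M := by
    refine (Finset.single_le_sum (f := fun x => w x ζ) (fun i _ => hw0 i ζ) hx).trans ?_
    exact (le_abs_self _).trans (hM ζ hζ)
  have hRM : ‖rightNum ρ s u η N x ζ / leftAmp ρ N ζ‖ ≤ M :=
    (le_add_of_nonneg_right (norm_nonneg _)).trans hwM
  have hLM : ‖leftNum ρ η N x ζ / leftAmp ρ N ζ‖ ≤ M :=
    (le_add_of_nonneg_left (norm_nonneg _)).trans hwM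
  rw [add_div, mul_div_assoc, mul_div_assoc, add_mul]
  refine (norm_add_le _ _).trans ?_
  rw [norm_mul, norm_mul]
  gcongr

theorem CoinPhases.entry_one_one_ne_zero (h : CoinPhases U ρ s δ u η) : U 1 1 ≠ 0 := by
  rw [← norm_ne_zero_iff, h.entry_one_one, norm_mul, norm_mul, h.norm_eta, h.norm_delta,
    Complex.norm_real, Real.norm_of_nonneg h.rho_pos.le, one_mul, one_mul]
  exact h.rho_pos.ne'

/-- The total absorption probability at `0` is the squared `L²` norm of the generating function. -/
theorem CoinPhases.hasSum_absorbed (h : CoinPhases U ρ s δ u η)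
    (hU : U ∈ Matrix.unitaryGroup (Fin 2) ℂ) {N : ℕ} (hN : 1 ≤ N) {ψ : WalkState}
    (hψ : Confined (N + 1) ψ) :
    HasSum (fun t : ℕ => ‖walkOp U ((stepOp U (N + 1) ^ t) ψ) (0, 1)‖ ^ 2)
      (pairingEnergy ρ s u η N ψ) := by
  rw [hasSum_iff_tendsto_nat_of_nonneg fun _ => sq_nonneg _]
  have hpart : ∀ T : ℕ, ∑ t ∈ Finset.range T, ‖walkOp U ((stepOp U (N + 1) ^ t) ψ) (0, 1)‖ ^ 2
      = pairingEnergy ρ s u η N ψ - pairingEnergy ρ s u η N ((stepOp U (N + 1) ^ T) ψ) := by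
    intro T
    induction T with
    | zero => simp
    | succ T ih =>
      rw [Finset.sum_range_succ, ih, h.pairingEnergy_eq hN (hψ.pow U T), stepOp_pow_succ]
      ring
  obtain ⟨M, hM⟩ := h.exists_pairingEnergy_le N
  have hsum : Tendsto (fun T : ℕ => ((∑ x ∈ Finset.Ioo (0 : ℤ) (N + 1),
      (‖((stepOp U (N + 1) ^ T) ψ) (x, 0)‖ + ‖((stepOp U (N + 1) ^ T) ψ) (x, 1)‖)) * M) ^ 2)
      atTop (𝓝 0) := by
    have h1 := tendsto_finsetSum (Finset.Ioo (0 : ℤ) (N + 1)) fun x _ =>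
      (tendsto_state_zero hU h.entry_one_one_ne_zero (by omega) hψ x 0).norm.add
        (tendsto_state_zero hU h.entry_one_one_ne_zero (by omega) hψ x 1).norm
    simpa using (h1.mul_const M).pow 2
  have hE : Tendsto (fun T : ℕ => pairingEnergy ρ s u η N ((stepOp U (N + 1) ^ T) ψ)) atTop
      (𝓝 0) :=
    squeeze_zero (fun T => Real.circleAverage_nonneg_of_nonneg fun _ _ => by positivity)
      (fun T => hM _) hsum
  simpa [hpart] using hE.const_sub (pairingEnergy ρ s u η N ψ)

theorem CoinPhases.pairingEnergy_initState (h : CoinPhases U ρ s δ u η) {N : ℕ} {m : ℤ}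
    (h0 : 0 < m) (hm : m < N + 1) (α β : ℂ) :
    (pairingEnergy ρ s u η N (initState m α β) : ℂ)
      = quadAverage ρ N (β - α * conj u * η⁻¹ * (s / ρ)) (-β / ρ) (N - m) := by
  have hη : η ≠ 0 := by rintro rfl; simpa using h.norm_eta
  have hηn : ‖η ^ m‖ = 1 := by rw [norm_zpow, h.norm_eta, one_zpow]
  have hnum : ∀ ζ, pairingNum ρ s u η N (initState m α β) ζ
      = α * rightNum ρ s u η N m ζ + β * leftNum ρ η N m ζ := by
    intro ζ
    rw [pairingNum, Finset.sum_eq_single_of_mem m (Finset.mem_Ioo.2 ⟨h0, hm⟩)]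
    · simp [initState_apply]
    · intro x _ hx
      simp [initState_apply, hx]
  have hc : ContinuousOn (fun ζ => ‖pairing ρ s u η N (initState m α β) ζ‖ ^ 2)
      (Metric.sphere 0 |1|) := (h.continuousOn_pairing N (initState m α β)).norm.pow 2
  rw [pairingEnergy, quadAverage]
  refine (Complex.ofRealCLM.circleAverage_comp_comm hc.circleIntegrable').symm.trans ?_
  apply Real.circleAverage_congr_sphere
  intro ζ hζ
  have hζ1 : ‖ζ‖ = 1 := by simpa using hζ
  have e : pairing ρ s u η N (initState m α β) ζ
      = η ^ m * (((β - α * conj u * η⁻¹ * (s / ρ)) * chebV ρ (N - m + 1) ζ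
        + -β / ρ * ζ * chebV ρ (N - m) ζ) / leftAmp ρ N ζ) := by
    rw [pairing, hnum, rightNum, leftNum, leftAmp, zpow_sub_one₀ hη,
      show (N : ℤ) + 1 - m = N - m + 1 by ring]
    ring
  have e' : ‖pairing ρ s u η N (initState m α β) ζ‖
      = ‖((β - α * conj u * η⁻¹ * (s / ρ)) * chebV ρ (N - m + 1) ζ
        + -β / ρ * ζ * chebV ρ (N - m) ζ) / leftAmp ρ N ζ‖ := by
    rw [e, norm_mul, hηn, one_mul]
  simp only [Function.comp_apply, Complex.ofRealCLM_apply, e']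
  push_cast
  rw [← Complex.mul_conj']
  generalize β - α * conj u * η⁻¹ * (s / ρ) = lam
  generalize -β / (ρ : ℂ) = nu
  simp only [map_div₀, map_add, map_mul, conj_chebV hζ1, conj_leftAmp hζ1,
    conj_eq_inv_of_norm_one hζ1, quadForm]
  rw [div_mul_div_comm]

theorem CoinPhases.absorptionProb_eq (h : CoinPhases U ρ s δ u η)
    (hU : U ∈ Matrix.unitaryGroup (Fin 2) ℂ) {N : ℕ} {m : ℤ} (h0 : 0 < m) (hm : m < N + 1)
    (α β : ℂ) :
    (absorptionProb U (N + 1) m α β : ℂ)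
      = quadAverage ρ N (β - α * conj u * η⁻¹ * (s / ρ)) (-β / ρ) (N - m) := by
  rw [← h.pairingEnergy_initState h0 hm, absorptionProb]
  congr 1
  simp only [absorptionAt_eq h0 hm]
  exact (h.hasSum_absorbed hU (by omega) (confined_initState h0 hm α β)).tsum_eq

theorem CoinPhases.absorptionProb_one (h : CoinPhases U ρ s δ u η)
    (hU : U ∈ Matrix.unitaryGroup (Fin 2) ℂ) {N : ℕ} (hN : 1 ≤ N) :
    (absorptionProb U (N + 1) 1 1 0 : ℂ) = s ^ 2 / ρ * (chebV ρ N 1 / leftAmp ρ N 1) := by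
  have hρ : (ρ : ℂ) ≠ 0 := by exact_mod_cast h.rho_pos.ne'
  have hu : u * conj u = 1 := by rw [Complex.mul_conj', h.norm_u]; simp
  have hη : η⁻¹ * conj η⁻¹ = 1 := by rw [Complex.mul_conj', norm_inv, h.norm_eta]; simp
  rw [h.absorptionProb_eq hU one_pos (by omega), quadAverage]
  have e := Real.circleAverage_fun_smul (a := (s ^ 2 / ρ ^ 2 : ℂ))
    (f := fun ζ => chebV ρ N ζ ^ 2 / (leftAmp ρ N ζ * leftAmpConj ρ N ζ)) (c := 0) (R := 1)
  rw [circleAverage_chebV_sq h.rho_pos h.s_nonneg h.sq_add_sq] at e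
  rw [show (s ^ 2 / ρ * (chebV ρ N 1 / leftAmp ρ N 1) : ℂ)
    = (s ^ 2 / ρ ^ 2 : ℂ) • (ρ * (chebV ρ N 1 / leftAmp ρ N 1)) by
      rw [smul_eq_mul]; field_simp, ← e]
  congr 1
  ext ζ
  simp only [quadForm, sub_add_cancel, map_mul, map_zero, Complex.conj_conj,
    neg_zero, zero_div, zero_mul, add_zero, zero_sub, one_mul, map_neg, map_div₀,
    Complex.conj_ofReal, smul_eq_mul]
  linear_combination (s ^ 2 / ρ ^ 2 * chebV ρ N ζ ^ 2 / (leftAmp ρ N ζ * leftAmpConj ρ N ζ)) *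
    (hu * (η⁻¹ * conj η⁻¹) + hη)

theorem CoinPhases.absorptionProb_succ (h : CoinPhases U ρ s δ u η)
    (hU : U ∈ Matrix.unitaryGroup (Fin 2) ℂ) {N : ℕ} (hN : 1 ≤ N) :
    absorptionProb U (N + 1 + 1) 1 1 0
      = (s ^ 2 + absorptionProb U (N + 1) 1 1 0) / (1 + absorptionProb U (N + 1) 1 1 0) := by
  have hρ : (ρ : ℂ) ≠ 0 := by exact_mod_cast h.rho_pos.ne'
  apply Complex.ofReal_injective
  have hs : (s : ℂ) ^ 2 = 1 - ρ ^ 2 := by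
    have : (ρ ^ 2 + s ^ 2 : ℂ) = 1 := by exact_mod_cast h.sq_add_sq
    linear_combination this
  have h1 := h.absorptionProb_one hU hN
  have h2 := h.absorptionProb_one hU (N := N + 1) (by omega)
  have y1 := leftAmp_ne_zero h.rho_pos h.s_nonneg h.sq_add_sq (norm_one (α := ℂ)) N
  have y2 := leftAmp_ne_zero h.rho_pos h.s_nonneg h.sq_add_sq (norm_one (α := ℂ)) (N + 1)
  have hr := chebV_add_one ρ (N + 1) 1
  rw [add_sub_cancel_right] at hr
  push_cast at h2 y2 ⊢
  have e1 : chebV ρ ((N : ℤ) + 1) 1 = leftAmp ρ N 1 + chebV ρ N 1 / ρ := by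
    rw [leftAmp]; ring
  obtain ⟨D, hD⟩ : ∃ D : ℂ, D = ρ * leftAmp ρ N 1 + s ^ 2 * chebV ρ N 1 := ⟨_, rfl⟩
  have e2 : leftAmp ρ ((N : ℤ) + 1) 1 = D / ρ ^ 2 := by
    rw [hD, hs, leftAmp, hr, e1]
    field_simp
    ring
  have e3 : 1 + s ^ 2 / ρ * (chebV ρ N 1 / leftAmp ρ N 1) = D / (ρ * leftAmp ρ N 1) := by
    rw [hD]
    field_simp
  rw [e2] at y2
  have hD0 : D ≠ 0 := (div_ne_zero_iff.1 y2).1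
  rw [h1, h2, e1, e2, e3]
  field_simp

/-- With zero diagonal, the coin turns the walker around, and from `|1⟩|R⟩` it reaches `0` in the first
step. -/
theorem absorptionProb_of_diag_zero (hU : U ∈ Matrix.unitaryGroup (Fin 2) ℂ) (ha : U 0 0 = 0)
    {n : ℤ} (hn : 2 ≤ n) : absorptionProb U n 1 1 0 = 1 := by
  have hc : ‖U 1 0‖ ^ 2 = 1 := by simpa [ha] using unitary_norm_sq hU 1 0
  have hzero : stepOp U n (initState 1 1 0) = 0 := by
    ext ⟨x, c⟩
    rw [stepOp_apply]
    split_ifs with hx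
    · rfl
    · fin_cases c
      · simp [walkOp_apply_zero, initState_apply, ha]
      · have : x + 1 ≠ 1 := by omega
        simp [walkOp_apply_one, initState_apply, this]
  rw [absorptionProb, tsum_eq_single 0]
  · rw [absorptionAt_eq one_pos (by omega)]
    simp [walkOp_apply_one, initState_apply, hc]
  · intro t ht
    obtain ⟨t, rfl⟩ := Nat.exists_eq_succ_of_ne_zero ht
    have hpow : (stepOp U n ^ (t + 1)) (initState 1 1 0) = 0 := by
      rw [pow_succ, Module.End.mul_apply, hzero, map_zero]
    rw [absorptionAt_eq one_pos (by omega), Nat.succ_eq_add_one, hpow]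
    simp

theorem CoinPhases.absorptionProb_recurrence (h : CoinPhases U ρ s δ u η)
    (hU : U ∈ Matrix.unitaryGroup (Fin 2) ℂ) {N : ℕ} {m : ℤ} (h0 : 0 < m) (hm : m + 3 < N + 1)
    (α β : ℂ) :
    absorptionProb U (N + 1) (m + 3) α β
      - (4 / ρ ^ 2 - 1) * absorptionProb U (N + 1) (m + 2) α β
      + (4 / ρ ^ 2 - 1) * absorptionProb U (N + 1) (m + 1) α β
      - absorptionProb U (N + 1) m α β = 0 := by
  apply Complex.ofReal_injective
  push_cast
  have hr := quadAverage_recurrence h.rho_pos h.s_nonneg h.sq_add_sq (N := N)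
    (β - α * conj u * η⁻¹ * (s / ρ)) (-β / ρ) (k := N - (m + 3)) (by omega) (by omega)
  rw [show (N : ℤ) - (m + 3) + 3 = N - m by ring, show (N : ℤ) - (m + 3) + 2 = N - (m + 1) by ring,
    show (N : ℤ) - (m + 3) + 1 = N - (m + 2) by ring] at hr
  rw [h.absorptionProb_eq hU h0 (by omega), h.absorptionProb_eq hU (m := m + 1) (by omega) (by omega),
    h.absorptionProb_eq hU (m := m + 2) (by omega) (by omega),
    h.absorptionProb_eq hU (m := m + 3) (by omega) hm]
  linear_combination -hr

end

theorem theorem4p6 (U : Matrix (Fin 2) (Fin 2) ℂ) (hU : U ∈ Matrix.unitaryGroup (Fin 2) ℂ)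
    (a b : ℂ) (ha : U 0 0 = a) (hb : U 0 1 = b) :
    (∀ n m : ℤ, 0 < m → m < n → ∀ α β : ℂ, Summable (absorptionAt U n m α β)) ∧
    (∀ n : ℤ, 2 ≤ n →
      absorptionProb U (n + 1) 1 1 0 =
        (‖b‖ ^ 2 + absorptionProb U n 1 1 0) / (1 + absorptionProb U n 1 1 0)) ∧
    (a ≠ 0 → ∀ n m : ℤ, 0 < m → m + 3 < n → ∀ α β : ℂ,
      absorptionProb U n (m + 3) α β
        - (4 / ‖a‖ ^ 2 - 1) * absorptionProb U n (m + 2) α β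
        + (4 / ‖a‖ ^ 2 - 1) * absorptionProb U n (m + 1) α β
        - absorptionProb U n m α β = 0) := by
  subst ha hb
  refine ⟨fun n m h0 hm α β => ?_, fun n hn => ?_, fun ha n m h0 hm α β => ?_⟩
  · refine (summable_absorbed hU (n := n) (by omega) (confined_initState h0 hm α β)).congr
      fun t => ?_
    rw [absorptionAt_eq h0 hm]
  · by_cases ha : U 0 0 = 0
    · have hb : ‖U 0 1‖ ^ 2 = 1 := by
        have h := congrFun (congrFun (Matrix.mem_unitaryGroup_iff.1 hU) 0) 0
        simp only [Matrix.mul_apply, Fin.sum_univ_two, Matrix.star_apply, RCLike.star_def, ha,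
          Matrix.one_apply_eq, map_zero, mul_zero, zero_add] at h
        rw [Complex.mul_conj'] at h
        exact_mod_cast h
      rw [absorptionProb_of_diag_zero hU ha hn, absorptionProb_of_diag_zero hU ha (by omega), hb]
      norm_num
    · obtain ⟨δ, u, η, h⟩ := exists_coinPhases hU ha
      obtain ⟨N, rfl⟩ : ∃ N : ℕ, n = N + 1 := ⟨(n - 1).toNat, by omega⟩
      exact h.absorptionProb_succ hU (by omega)
  · obtain ⟨δ, u, η, h⟩ := exists_coinPhases hU ha
    obtain ⟨N, rfl⟩ : ∃ N : ℕ, n = N + 1 := ⟨(n - 1).toNat, by omega⟩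
    exact h.absorptionProb_recurrence hU h0 hm α β
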